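/- Let $\mathcal{A}$ be an abelian length category, i.e. an abelian category in which every object has finite length. By a subcategory we mean a full subcategory closed under isomorphisms, and for a subcategory $\mathcal{C}$ we write $\mathcal{C}^\perp=\{X:\mathrm{Hom}(C,X)=0\ \forall C\in\mathcal{C}\}$ and ${}^\perp\mathcal{C}=\{X:\mathrm{Hom}(X,C)=0\ \forall C\in\mathcal{C}\}$. A subcategory $\mathcal{T}$ is a torsion class if there is a subcategory $\mathcal{F}$ with $\mathcal{F}=\mathcal{T}^\perp$ and $\mathcal{T}={}^\perp\mathcal{F}$; the set $\mathrm{tors}\,\mathcal{A}$ of torsion classes, ordered by inclusion, is a complete lattice whose meets are intersections. A subcategory is wide if it is nonempty and closed under extensions, kernels and cokernels. Let $L$ be a complete lattice, and write $x\lessdot y$ if $y$ covers $x$. An interval $I=[I^-,I^+]$ of $L$ is binuclear if $$I^-=I^+\wedge\bigwedge\{z: I^-\le z\lessdot I^+\}\quad\text{and}\quad I^+=I^-\vee\bigvee\{z: I^-\lessdot z\le I^+\}.$$ The set $\mathrm{binuc}(L)$ of binuclear intervals is partially ordered by $I\le J$ if and only if $I^-\le J^-$ and $I^+\le J^+$.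 A completely semidistributive lattice is a complete lattice such that, for all elements $x,y$ and every nonempty subset $S$, if $x\wedge s=y$ for all $s\in S$ then $x\wedge\bigvee S=y$, and if $x\vee s=y$ for all $s\in S$ then $x\vee\bigwedge S=y$. The heart of $I\in\mathrm{binuc}(\mathrm{tors}\,\mathcal{A})$ is the subcategory $(I^-)^\perp\cap I^+$. For a subcategory $\mathcal{W}$ of $\mathcal{A}$, let $C(\mathcal{W})$ be the set of those $I\in\mathrm{binuc}(\mathrm{tors}\,\mathcal{A})$ whose heart equals $\mathcal{W}$, with the induced order. **Theorem.** 1. For every wide subcategory $\mathcal{W}$ of $\mathcal{A}$: * $C(\mathcal{W})$ is a completely semidistributive lattice. * Meets and joins of nonempty families in $C(\mathcal{W})$ are computed componentwise: if $\emptyset\neq\mathcal{I}\subseteq C(\mathcal{W})$, then $[\bigwedge_{I\in\mathcal{I}}I^-,\bigwedge_{I\in\mathcal{I}}I^+]$ and $[\bigvee_{I\in\mathcal{I}}I^-,\bigvee_{I\in\mathcal{I}}I^+]$ (meets and joins of endpoints taken in $\mathrm{tors}\,\mathcal{A}$) belong to $C(\mathcal{W})$, and they are the meet and the join of $\mathcal{I}$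 in $\mathrm{binuc}(\mathrm{tors}\,\mathcal{A})$, hence also in $C(\mathcal{W})$. * If $\mathrm{binuc}(\mathrm{tors}\,\mathcal{A})$ is a lattice, then $C(\mathcal{W})$ is a sublattice of it. 2. The subcategory $0$ of zero objects is wide, and $\mathcal{T}\mapsto[\mathcal{T},\mathcal{T}]$ is an isomorphism of posets $\mathrm{tors}\,\mathcal{A}\to C(0)$, under which the meet and the join of two torsion classes become the meet and the join of their images in $\mathrm{binuc}(\mathrm{tors}\,\mathcal{A})$. 3. The sets $C(\mathcal{W})$, for $\mathcal{W}$ ranging over the wide subcategories of $\mathcal{A}$, form a partition of $\mathrm{binuc}(\mathrm{tors}\,\mathcal{A})$ into nonempty sets. So $\mathrm{binuc}(\mathrm{tors}\,\mathcal{A})$ is partitioned into completely semidistributive lattices, one of which is isomorphic to $\mathrm{tors}\,\mathcal{A}$. -/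

import Mathlib

universe v u

open CategoryTheory

/-! ### Order-theoretic notions -/

section Order

/-- A poset is a lattice if any two elements have a least upper bound and a greatest
lower bound. -/
def IsLatticeOrder (P : Type u) [PartialOrder P] : Prop :=
  ∀ a b : P, (∃ c, IsLUB {a, b} c) ∧ ∃ c, IsGLB {a, b} c

/-- `S` is a sublattice of the lattice `P`: it is closed under the joins and meets of pairs
of its elements, taken in `P`. -/
def IsSublatticeOf {P : Type u} [PartialOrder P] (S : Set P) : Prop :=
  ∀ a ∈ S, ∀ b ∈ S, (∀ c, IsLUB {a, b} c → c ∈ S) ∧ ∀ c, IsGLB {a, b} c → c ∈ S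

/-- A poset `P` is a completely semidistributive lattice if all joins and meets exist, if
`x ∧ s = y` for all `s` in a nonempty set `S` implies `x ∧ ⋁ S = y`, and dually. -/
structure IsCompletelySemidistributive (P : Type u) [PartialOrder P] : Prop where
  exists_isLUB : ∀ S : Set P, ∃ a, IsLUB S a
  exists_isGLB : ∀ S : Set P, ∃ a, IsGLB S a
  meet_semidistributive : ∀ (x y : P) (S : Set P), S.Nonempty →
    (∀ s ∈ S, IsGLB {x, s} y) → ∀ b, IsLUB S b → IsGLB {x, b} y
  join_semidistributive : ∀ (x y : P) (S : Set P), S.Nonempty →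
    (∀ s ∈ S, IsLUB {x, s} y) → ∀ b, IsGLB S b → IsLUB {x, b} y

variable {L : Type u} [CompleteLattice L]

/-- `pop_x(y) = y ∧ ⋀ {z | x ≤ z ⋖ y}`. -/
def popDown (x y : L) : L := y ⊓ sInf {z | x ≤ z ∧ z ⋖ y}

/-- `pop^y(x) = x ∨ ⋁ {z | x ⋖ z ≤ y}`. -/
def popUp (x y : L) : L := x ⊔ sSup {z | x ⋖ z ∧ z ≤ y}

variable (L) in
/-- A binuclear interval `I = [I⁻, I⁺]` of a complete lattice, given by its endpoints
`I⁻ = lo ≤ hi = I⁺`. -/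
@[ext]
structure Binuc where
  lo : L
  hi : L
  lo_le_hi : lo ≤ hi
  nuclear : lo = popDown lo hi
  conuclear : hi = popUp lo hi

/-- The binuclear interval order: `I ≤ J` iff `I⁻ ≤ J⁻` and `I⁺ ≤ J⁺`. -/
instance : PartialOrder (Binuc L) where
  le I J := I.lo ≤ J.lo ∧ I.hi ≤ J.hi
  le_refl _ := ⟨le_rfl, le_rfl⟩
  le_trans _ _ _ h k := ⟨h.1.trans k.1, h.2.trans k.2⟩
  le_antisymm _ _ h k := Binuc.ext (le_antisymm h.1 k.1) (le_antisymm h.2 k.2)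

end Order

/-! ### Torsion classes and wide subcategories

A full subcategory closed under isomorphisms is an isomorphism-closed `ObjectProperty`. -/

section Torsion

variable (A : Type u) [Category.{v} A] [Abelian A]

/-- An abelian length category: every object has finite length, that is, its subobjects
satisfy both chain conditions. -/
class IsLengthCategory : Prop where
  noetherian : ∀ X : A, IsNoetherianObject X
  artinian : ∀ X : A, IsArtinianObject X

variable {A}

/-- A torsion pair `(T, F)`: `F` consists of the `X` with `Hom(T, X) = 0`, and `T` consists
of the `X` with `Hom(X, F) = 0`. -/
structure IsTorsionPair (T F : ObjectProperty A) : Prop where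
  right_eq : F = T.rightOrthogonal
  left_eq : T = F.leftOrthogonal

/-- A torsion class is the first component of a torsion pair. -/
def IsTorsionClass (T : ObjectProperty A) : Prop := ∃ F, IsTorsionPair T F

lemma isTorsionClass_leftOrthogonal (G : ObjectProperty A) :
    IsTorsionClass G.leftOrthogonal :=
  ⟨G.leftOrthogonal.rightOrthogonal, rfl, le_antisymm
    (fun _ hX _ f hY => hY f hX) (fun _ hX _ f hY => hX f (fun _ g hZ => hZ g hY))⟩

lemma isTorsionClass_sInf {S : Set (ObjectProperty A)} (hS : ∀ T ∈ S, IsTorsionClass T) :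
    IsTorsionClass (sInf S) := by
  have h : sInf S = ObjectProperty.leftOrthogonal (⨆ T ∈ S, T.rightOrthogonal) := by
    apply le_antisymm
    · intro X hX Y f hY
      simp only [ObjectProperty.prop_iSup_iff] at hY
      obtain ⟨T, hT, hY⟩ := hY
      exact hY f (sInf_le hT X hX)
    · refine le_sInf fun T hT X hX => ?_
      obtain ⟨F, h₁, h₂⟩ := hS T hT
      rw [h₂]
      intro Y f hY
      refine hX f ?_
      simp only [ObjectProperty.prop_iSup_iff]
      exact ⟨T, hT, h₁ ▸ hY⟩
  rw [h]
  exact isTorsionClass_leftOrthogonal _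

variable (A) in
/-- The poset `tors A` of torsion classes of `A`, ordered by inclusion. -/
abbrev Tors : Type u := {T : ObjectProperty A // IsTorsionClass T}

/-- `tors A` is a complete lattice, in which meets are intersections. -/
instance : CompleteLattice (Tors A) :=
  letI : InfSet (Tors A) :=
    ⟨fun S => ⟨sInf (Subtype.val '' S), isTorsionClass_sInf (by rintro _ ⟨T, _, rfl⟩; exact T.2)⟩⟩
  completeLatticeOfInf (Tors A) fun S =>
    ⟨fun T hT => show sInf (Subtype.val '' S) ≤ T.1 from sInf_le ⟨T, hT, rfl⟩,
      fun U hU => show U.1 ≤ sInf (Subtype.val '' S) from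
        le_sInf (by rintro _ ⟨T, hT, rfl⟩; exact hU hT)⟩

/-- The heart `(I⁻)^⊥ ∩ I⁺` of a binuclear interval `I` of torsion classes. -/
def heart (I : Binuc (Tors A)) : ObjectProperty A := I.lo.1.rightOrthogonal ⊓ I.hi.1

/-- A wide subcategory: a nonempty full subcategory, closed under isomorphisms, which is
closed under extensions, kernels and cokernels. -/
structure IsWide (W : ObjectProperty A) : Prop where
  containsZero : W.ContainsZero
  isClosedUnderIsomorphisms : W.IsClosedUnderIsomorphisms
  isClosedUnderExtensions : W.IsClosedUnderExtensions
  isClosedUnderKernels : W.IsClosedUnderKernels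
  isClosedUnderCokernels : W.IsClosedUnderCokernels

/-- The set `C(W)` of binuclear intervals of `tors A` with heart `W`. -/
def withHeart (W : ObjectProperty A) : Set (Binuc (Tors A)) := {I | heart I = W}

/-- The subcategory `0` of zero objects. -/
def zeroSubcategory : ObjectProperty A := fun X => Limits.IsZero X

end Torsion

/-!
The argument rests on an intrinsic description of the endpoints of the intervals `[U, T]` with a
prescribed heart.

*Binuclear means wide heart.* If `U ⋖ z`, pick a nonzero `U`-torsion-free object `B` of `z` with no
proper nonzero torsion-free quotient. Then every nonzero morphism from `B` to a `U`-torsion-free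
object is a monomorphism with torsion-free cokernel (`exists_label_of_covBy_up`). If `T` is the join
of `U` and the atoms of `[U, T]`, every nonzero object of the heart contains such a `B`, and by
induction on proper quotients cokernels of monomorphisms of the heart are torsion-free. The dual
argument with coatoms gives kernels, so the heart is wide (`isWide_heart`). Conversely, if the heart
is wide, its simple objects `S` give the atoms `U ∨ T(S)` and the coatoms `T ∧ ^⊥S`, and these
suffice to recover `T` from `U` and `U` from `T` (`eq_popUp_of_isWide`, `eq_popDown_of_isWide`).

*Intervals with heart `W`.* For `W` wide, `T` is the upper endpoint of an interval with heart `W` if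
and only if `W ⊆ T` and every morphism from an object of `T` to an object of `W` has its kernel in
`T` and its image in `W` (`isUpperEnd_of_heart`, `IsUpperEnd.heart_eq`); the lower endpoint is then
`T ∧ ^⊥W`. Both descriptions are visibly stable under intersections, so nonempty meets in `C(W)` are
componentwise. The dual description of lower endpoints through torsion-free classes gives the joins,
because the torsion-free class of a join is an intersection. The torsion class generated by `W`
satisfies the condition, so `C(W)` is nonempty (`isUpperEnd_generated`).

*Semidistributivity.* As bounds are componentwise, it is inherited from `tors A`, where it follows
by induction on proper quotients or subobjects (`Tors.inf_sSup_eq`, `Tors.sup_sInf_eq`): if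
`x ∧ s = y` for all `s ∈ S`, let `N` be a nonzero object of `x ∧ ⋁ S` that is torsion-free for `y`.
Some `s ∈ S` has a nonzero torsion part in `N`; the quotient by it is torsion-free for `s`, hence
for `y`, so it vanishes by induction, and `N` lies in `x ∧ s = y`, a contradiction.
-/

/-! ### Short exact sequences -/

section ShortExactSequences
open Limits

variable {A : Type u} [Category.{v} A] [Abelian A]

/-- `0 ⟶ X ⟶ Y ⟶ Z ⟶ 0` is a short exact sequence; the vanishing of the composition is part of
the statement, so that no bundled `ShortComplex` has to be named. -/
def IsSES {X Y Z : A} (f : X ⟶ Y) (g : Y ⟶ Z) : Prop :=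
  ∃ w : f ≫ g = 0, (ShortComplex.mk f g w).ShortExact

namespace IsSES

variable {X Y Z : A} {f : X ⟶ Y} {g : Y ⟶ Z}

lemma comp_eq_zero (h : IsSES f g) : f ≫ g = 0 := h.1

lemma mono (h : IsSES f g) : Mono f := h.2.mono_f

lemma epi (h : IsSES f g) : Epi g := h.2.epi_g

/-- Exactness in the middle may be checked on generalized elements, up to refinement. -/
lemma of_exact_up_to_refinements (w : f ≫ g = 0) [Mono f] [Epi g]
    (h : ∀ ⦃B : A⦄ (y : B ⟶ Y), y ≫ g = 0 →
      ∃ (B' : A) (π : B' ⟶ B) (_ : Epi π) (x : B' ⟶ X), π ≫ y = x ≫ f) : IsSES f g :=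
  ⟨w, { exact := (ShortComplex.exact_iff_exact_up_to_refinements _).2 h }⟩

lemma of_epi (g : Y ⟶ Z) [Epi g] : IsSES (kernel.ι g) g :=
  ⟨kernel.condition g, { exact := ShortComplex.exact_kernel g }⟩

lemma of_mono (f : X ⟶ Y) [Mono f] : IsSES f (cokernel.π f) :=
  ⟨cokernel.condition f, { exact := ShortComplex.exact_cokernel f }⟩

lemma lift (h : IsSES f g) {B : A} (k : B ⟶ Y) (hk : k ≫ g = 0) : ∃ l, l ≫ f = k := by
  have := h.mono
  exact ⟨h.2.exact.lift k hk, h.2.exact.lift_f k hk⟩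

lemma desc (h : IsSES f g) {B : A} (k : Y ⟶ B) (hk : f ≫ k = 0) : ∃ l, g ≫ l = k := by
  have := h.epi
  exact ⟨h.2.exact.desc k hk, h.2.exact.g_desc k hk⟩

lemma isIso_right (h : IsSES f g) (hX : IsZero X) : IsIso g := by
  have := h.epi
  have : Mono g := h.2.exact.mono_g (hX.eq_of_src _ _)
  exact isIso_of_mono_of_epi g

lemma isIso_left (h : IsSES f g) (hZ : IsZero Z) : IsIso f := by
  have := h.mono
  have : Epi f := h.2.exact.epi_f (hZ.eq_of_tgt _ _)
  exact isIso_of_mono_of_epi f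

lemma isZero_left (h : IsSES f g) [Mono g] : IsZero X := by
  have := h.mono
  exact IsZero.of_mono_eq_zero f ((cancel_mono g).1 (by rw [h.comp_eq_zero, zero_comp]))

lemma isZero_right (h : IsSES f g) [Epi f] : IsZero Z := by
  have := h.epi
  exact IsZero.of_epi_eq_zero g ((cancel_epi f).1 (by rw [h.comp_eq_zero, comp_zero]))

protected lemma op (h : IsSES f g) : IsSES g.op f.op :=
  ⟨by rw [← op_comp, h.comp_eq_zero, op_zero], h.2.op⟩

protected lemma unop {X Y Z : Aᵒᵖ} {f : X ⟶ Y} {g : Y ⟶ Z} (h : IsSES f g) :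
    IsSES g.unop f.unop :=
  ⟨by rw [← unop_comp, h.comp_eq_zero, unop_zero], h.2.unop⟩

end IsSES

/-- The kernel column of a map of short exact sequences with epimorphic components. -/
lemma IsSES.kernels {X' X X'' I' I I'' K' K K'' : A} {u : X' ⟶ X} {v : X ⟶ X''}
    {i : I' ⟶ I} {p : I ⟶ I''} {k' : K' ⟶ X'} {k : K ⟶ X} {k'' : K'' ⟶ X''}
    {e' : X' ⟶ I'} {e : X ⟶ I} {e'' : X'' ⟶ I''}
    (hX : IsSES u v) (hI : IsSES i p) (h' : IsSES k' e') (h : IsSES k e) (h'' : IsSES k'' e'')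
    (hl : u ≫ e = e' ≫ i) (hr : v ≫ e'' = e ≫ p) :
    ∃ (a : K' ⟶ K) (b : K ⟶ K''), IsSES a b ∧ a ≫ k = k' ≫ u ∧ b ≫ k'' = k ≫ v := by
  obtain ⟨a, ha⟩ := h.lift (k' ≫ u) (by
    rw [Category.assoc, hl, ← Category.assoc, h'.comp_eq_zero, zero_comp])
  obtain ⟨b, hb⟩ := h''.lift (k ≫ v) (by
    rw [Category.assoc, hr, ← Category.assoc, h.comp_eq_zero, zero_comp])
  have := h.mono
  have := h'.mono
  have := h''.mono
  have := hX.mono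
  have := hX.epi
  have := hI.mono
  have := h'.epi
  have : Mono a := by
    have : Mono (a ≫ k) := by rw [ha]; infer_instance
    exact mono_of_mono a k
  have : Epi b := by
    rw [epi_iff_surjective_up_to_refinements]
    intro B y
    obtain ⟨B₁, π₁, _, x, hx⟩ := surjective_up_to_refinements_of_epi v (y ≫ k'')
    obtain ⟨z, hz⟩ := hI.lift (x ≫ e) (by
      rw [Category.assoc, ← hr, ← Category.assoc, ← hx]
      simp [h''.comp_eq_zero])
    obtain ⟨B₂, π₂, _, x', hx'⟩ := surjective_up_to_refinements_of_epi e' z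
    obtain ⟨l, hl'⟩ := h.lift (π₂ ≫ x - x' ≫ u) (by
      rw [Preadditive.sub_comp, Category.assoc, Category.assoc, hl, ← hz, reassoc_of% hx', sub_self])
    refine ⟨B₂, π₂ ≫ π₁, inferInstance, l, ?_⟩
    rw [← cancel_mono k'', Category.assoc, Category.assoc, Category.assoc, hb, ← Category.assoc l,
      hl', Preadditive.sub_comp, Category.assoc, Category.assoc, hX.comp_eq_zero, hx]
    simp
  refine ⟨a, b, IsSES.of_exact_up_to_refinements ?_ ?_, ha, hb⟩
  · rw [← cancel_mono k'', Category.assoc, hb, ← Category.assoc, ha, Category.assoc,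
      hX.comp_eq_zero]
    simp
  · intro B y hy
    obtain ⟨z, hz⟩ := hX.lift (y ≫ k) (by
      rw [Category.assoc, ← hb, ← Category.assoc, hy, zero_comp])
    obtain ⟨x, hx⟩ := h'.lift z (by
      rw [← cancel_mono i, Category.assoc, ← hl, ← Category.assoc, hz, Category.assoc,
        h.comp_eq_zero]
      simp)
    refine ⟨B, 𝟙 B, inferInstance, x, ?_⟩
    rw [← cancel_mono k, Category.assoc, Category.assoc, ha, ← Category.assoc x, hx, hz,
      Category.id_comp]

/-- The kernel of a composition `p ≫ q` of epimorphisms is an extension of the kernel of `q` by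
the kernel of `p`. -/
lemma IsSES.kernel_comp {X Y Z K L M : A} {i : K ⟶ X} {p : X ⟶ Y} {j : L ⟶ Y} {q : Y ⟶ Z}
    {k : M ⟶ X} (hp : IsSES i p) (hq : IsSES j q) (hpq : IsSES k (p ≫ q)) :
    ∃ (a : K ⟶ M) (b : M ⟶ L), IsSES a b ∧ a ≫ k = i ∧ b ≫ j = k ≫ p := by
  have := hp.epi
  have := hq.mono
  have := hp.mono
  have := hpq.mono
  obtain ⟨a, ha⟩ := hpq.lift i (by rw [← Category.assoc, hp.comp_eq_zero, zero_comp])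
  obtain ⟨b, hb⟩ := hq.lift (k ≫ p) (by rw [Category.assoc, hpq.comp_eq_zero])
  have : Mono a := by
    have : Mono (a ≫ k) := by rw [ha]; infer_instance
    exact mono_of_mono a k
  have : Epi b := by
    rw [epi_iff_surjective_up_to_refinements]
    intro B y
    obtain ⟨B₁, π₁, _, x, hx⟩ := surjective_up_to_refinements_of_epi p (y ≫ j)
    obtain ⟨l, hl⟩ := hpq.lift x (by
      rw [← Category.assoc, ← hx]
      simp [hq.comp_eq_zero])
    refine ⟨B₁, π₁, inferInstance, l, ?_⟩
    rw [← cancel_mono j, Category.assoc, Category.assoc, hb, ← Category.assoc l, hl, hx]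
  refine ⟨a, b, IsSES.of_exact_up_to_refinements ?_ ?_, ha, hb⟩
  · rw [← cancel_mono j, Category.assoc, hb, ← Category.assoc, ha, hp.comp_eq_zero, zero_comp]
  · intro B y hy
    obtain ⟨x, hx⟩ := hp.lift (y ≫ k) (by
      rw [Category.assoc, ← hb, ← Category.assoc, hy, zero_comp])
    refine ⟨B, 𝟙 B, inferInstance, x, ?_⟩
    rw [← cancel_mono k, Category.assoc, Category.assoc, ha, hx, Category.id_comp]

/-- The cokernel of a composition `i ≫ j` of monomorphisms is an extension of the cokernel of `j`
by the cokernel of `i`. -/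
lemma IsSES.cokernel_comp {X Y Z C D E : A} {i : X ⟶ Y} {p : Y ⟶ C} {j : Y ⟶ Z} {q : Z ⟶ D}
    {r : Z ⟶ E} (hi : IsSES i p) (hj : IsSES j q) (hij : IsSES (i ≫ j) r) :
    ∃ (a : C ⟶ E) (b : E ⟶ D), IsSES a b ∧ p ≫ a = j ≫ r ∧ r ≫ b = q := by
  obtain ⟨a, b, h, h₁, h₂⟩ := hj.op.kernel_comp hi.op (by rw [← op_comp]; exact hij.op)
  exact ⟨b.unop, a.unop, h.unop, congrArg Quiver.Hom.unop h₂, congrArg Quiver.Hom.unop h₁⟩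

lemma IsSES.kernel_image {X Y : A} (f : X ⟶ Y) :
    IsSES (kernel.ι f) (Abelian.factorThruImage f) := by
  refine IsSES.of_exact_up_to_refinements ((cancel_mono (Abelian.image.ι f)).1 (by simp))
    fun B y hy => ?_
  have hyf : y ≫ f = 0 := by
    rw [← Abelian.image.fac f, ← Category.assoc, hy, zero_comp]
  exact ⟨B, 𝟙 B, inferInstance, kernel.lift f y hyf, by simp⟩

end ShortExactSequences

/-! ### Induction on proper quotients and subobjects -/

section Induction
open Limits

variable {A : Type u} [Category.{v} A] [Abelian A] [IsLengthCategory A]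

/-- Noetherian induction: to prove a property of an object, it may be assumed for all of its
proper quotients. -/
lemma quotient_induction {P : A → Prop}
    (h : ∀ X, (∀ ⦃K Q : A⦄ (f : K ⟶ X) (g : X ⟶ Q), IsSES f g → ¬ IsZero K → P Q) → P X)
    (X : A) : P X := by
  have := IsLengthCategory.noetherian X
  suffices H : ∀ (s : Subobject X) (Q : A) (p : X ⟶ Q) [Epi p], kernelSubobject p = s → P Q from
    H _ X (𝟙 X) rfl
  intro s
  induction s using WellFoundedGT.induction with
  | ind s ih =>
  rintro Q p _ rfl
  refine h Q fun K R f g hfg hK => ?_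
  have := hfg.epi
  have := hfg.mono
  refine ih (kernelSubobject (p ≫ g)) (lt_of_le_of_ne (kernelSubobject_comp_le p g) fun heq => ?_)
    R (p ≫ g) rfl
  apply hK
  obtain ⟨B, π, _, x, hx⟩ := surjective_up_to_refinements_of_epi p f
  have hx0 : (kernelSubobject p).Factors x := by
    rw [heq, kernelSubobject_factors_iff, ← Category.assoc, ← hx, Category.assoc,
      hfg.comp_eq_zero, comp_zero]
  rw [kernelSubobject_factors_iff, ← hx] at hx0
  exact IsZero.of_mono_eq_zero f ((cancel_epi π).1 (by rw [hx0, comp_zero]))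

/-- Artinian induction: to prove a property of an object, it may be assumed for all of its
proper subobjects. -/
lemma subobject_induction {P : A → Prop}
    (h : ∀ X, (∀ ⦃K Q : A⦄ (f : K ⟶ X) (g : X ⟶ Q), IsSES f g → ¬ IsZero Q → P K) → P X)
    (X : A) : P X := by
  have := IsLengthCategory.artinian X
  suffices H : ∀ (s : Subobject X) (K : A) (i : K ⟶ X) [Mono i], Subobject.mk i = s → P K from
    H _ X (𝟙 X) rfl
  intro s
  induction s using WellFoundedLT.induction with
  | ind s ih =>
  rintro K i _ rfl
  refine h K fun L Q f g hfg hQ => ?_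
  have := hfg.epi
  have := hfg.mono
  refine ih (Subobject.mk (f ≫ i)) (lt_of_le_of_ne
    (Subobject.mk_le_mk_of_comm f rfl) fun heq => ?_) L (f ≫ i) rfl
  apply hQ
  obtain ⟨x, hx⟩ : ∃ x : K ⟶ L, x ≫ f ≫ i = i :=
    ⟨Subobject.ofMkLEMk i (f ≫ i) heq.ge, Subobject.ofMkLEMk_comp heq.ge⟩
  have : x ≫ f = 𝟙 K := by rw [← cancel_mono i, Category.assoc, hx, Category.id_comp]
  have : Epi f := by
    have : Epi (x ≫ f) := by rw [this]; infer_instance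
    exact epi_of_epi x f
  exact hfg.isZero_right

end Induction

/-! ### Torsion classes -/

section TorsionClasses
open Limits

variable {A : Type u} [Category.{v} A] [Abelian A]

lemma rightOrthogonal_of_mono {P : ObjectProperty A} {X Y : A} (f : X ⟶ Y) [Mono f]
    (h : P.rightOrthogonal Y) : P.rightOrthogonal X := fun _ g hZ => by
  rw [← cancel_mono f, h (g ≫ f) hZ, zero_comp]

lemma leftOrthogonal_of_epi {P : ObjectProperty A} {X Y : A} (f : X ⟶ Y) [Epi f]
    (h : P.leftOrthogonal X) : P.leftOrthogonal Y := fun _ g hZ => by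
  rw [← cancel_epi f, h (f ≫ g) hZ, comp_zero]

lemma IsSES.rightOrthogonal {P : ObjectProperty A} {X Y Z : A} {f : X ⟶ Y} {g : Y ⟶ Z}
    (h : IsSES f g) (hX : P.rightOrthogonal X) (hZ : P.rightOrthogonal Z) :
    P.rightOrthogonal Y := fun B k hB => by
  obtain ⟨l, rfl⟩ := h.lift k (hZ _ hB)
  rw [hX l hB, zero_comp]

lemma IsSES.leftOrthogonal {P : ObjectProperty A} {X Y Z : A} {f : X ⟶ Y} {g : Y ⟶ Z}
    (h : IsSES f g) (hX : P.leftOrthogonal X) (hZ : P.leftOrthogonal Z) :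
    P.leftOrthogonal Y := fun B k hB => by
  obtain ⟨l, rfl⟩ := h.desc k (hX _ hB)
  rw [hZ l hB, comp_zero]

namespace Tors

lemma prop_iff (T : Tors A) (X : A) : T.1 X ↔ T.1.rightOrthogonal.leftOrthogonal X := by
  obtain ⟨F, h₁, h₂⟩ := T.2
  rw [← h₁, ← h₂]

lemma of_epi (T : Tors A) {X Y : A} (f : X ⟶ Y) [Epi f] (h : T.1 X) : T.1 Y := by
  rw [prop_iff] at h ⊢
  exact leftOrthogonal_of_epi f h

lemma of_ses (T : Tors A) {X Y Z : A} {f : X ⟶ Y} {g : Y ⟶ Z} (h : IsSES f g)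
    (hX : T.1 X) (hZ : T.1 Z) : T.1 Y := by
  rw [prop_iff] at hX hZ ⊢
  exact h.leftOrthogonal hX hZ

lemma of_isZero (T : Tors A) {X : A} (h : IsZero X) : T.1 X := by
  rw [prop_iff]
  exact fun _ f _ => h.eq_of_src f 0

lemma isZero (T : Tors A) {X : A} (h : T.1 X) (h' : T.1.rightOrthogonal X) : IsZero X :=
  (IsZero.iff_id_eq_zero X).2 (h' _ h)

lemma rightOrthogonal_anti {T U : Tors A} (h : T ≤ U) {X : A} (hX : U.1.rightOrthogonal X) :
    T.1.rightOrthogonal X := fun _ f hY => hX f (h _ hY)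

lemma sInf_prop (S : Set (Tors A)) (X : A) : (sInf S).1 X ↔ ∀ T ∈ S, T.1 X := by
  change (sInf (Subtype.val '' S) : ObjectProperty A) X ↔ _
  constructor
  · exact fun h T hT => sInf_le (α := ObjectProperty A) (Set.mem_image_of_mem _ hT) X h
  · intro h
    refine le_sInf (α := ObjectProperty A) (a := fun Y => ∀ T ∈ S, T.1 Y) ?_ X h
    rintro _ ⟨T, hT, rfl⟩ Y hY
    exact hY T hT

lemma inf_prop (T U : Tors A) (X : A) : (T ⊓ U).1 X ↔ T.1 X ∧ U.1 X := by
  rw [← sInf_pair, sInf_prop]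
  simp

lemma sSup_rightOrthogonal (S : Set (Tors A)) (X : A) :
    (sSup S).1.rightOrthogonal X ↔ ∀ T ∈ S, T.1.rightOrthogonal X := by
  refine ⟨fun h T hT => rightOrthogonal_anti (le_sSup hT) h, fun h Y f hY => ?_⟩
  have : sSup S ≤ ⟨_, isTorsionClass_leftOrthogonal (fun Z => Z = X)⟩ :=
    sSup_le fun T hT Z hZ _ g hg => by
      obtain rfl := hg
      exact h T hT g hZ
  exact this Y hY f rfl

lemma sup_rightOrthogonal (T U : Tors A) (X : A) :
    (T ⊔ U).1.rightOrthogonal X ↔ T.1.rightOrthogonal X ∧ U.1.rightOrthogonal X := by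
  rw [← sSup_pair, sSup_rightOrthogonal]
  simp

/-- The largest torsion class whose objects admit no nonzero morphism to an object of `P`. -/
def leftPerp (P : ObjectProperty A) : Tors A := ⟨_, isTorsionClass_leftOrthogonal P⟩

/-- The smallest torsion class containing `P`. -/
def generated (P : ObjectProperty A) : Tors A := leftPerp P.rightOrthogonal

lemma leftPerp_singleton_prop (B X : A) : (leftPerp (· = B)).1 X ↔ ∀ f : X ⟶ B, f = 0 :=
  ⟨fun h f => h f rfl, fun h _ f hY => by obtain rfl := hY; exact h f⟩

lemma generated_rightOrthogonal (P : ObjectProperty A) (X : A) :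
    (generated P).1.rightOrthogonal X ↔ P.rightOrthogonal X :=
  ⟨fun h _ f hY => h f fun _ g hZ => hZ g hY, fun h _ f hY => hY f h⟩

lemma generated_singleton_rightOrthogonal (B X : A) :
    (generated (· = B)).1.rightOrthogonal X ↔ ∀ f : B ⟶ X, f = 0 := by
  rw [generated_rightOrthogonal]
  exact ⟨fun h f => h f rfl, fun h _ f hY => by obtain rfl := hY; exact h f⟩

lemma le_generated {P : ObjectProperty A} {X : A} (h : P X) : (generated P).1 X :=
  fun _ f hY => hY f h

lemma generated_le {P : ObjectProperty A} {T : Tors A} (h : ∀ X, P X → T.1 X) :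
    generated P ≤ T := fun X hX => by
  rw [prop_iff]
  exact fun Y f hY => hX f fun Z g hZ => hY g (h Z hZ)

lemma generated_singleton_le {B : A} {T : Tors A} (h : T.1 B) : generated (· = B) ≤ T :=
  generated_le fun X hX => by obtain rfl := hX; exact h

variable [IsLengthCategory A]

/-- The torsion sequence `0 ⟶ tX ⟶ X ⟶ X/tX ⟶ 0` of an object. -/
lemma exists_torsion_ses (T : Tors A) (X : A) :
    ∃ (K Q : A) (i : K ⟶ X) (p : X ⟶ Q), IsSES i p ∧ T.1 K ∧ T.1.rightOrthogonal Q := by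
  induction X using quotient_induction with
  | h X ih =>
  by_cases hX : T.1.rightOrthogonal X
  · exact ⟨_, X, _, 𝟙 X, IsSES.of_epi (𝟙 X), T.of_isZero (isZero_kernel_of_mono (𝟙 X)), hX⟩
  · simp only [ObjectProperty.rightOrthogonal_iff, not_forall] at hX
    obtain ⟨E, f, hE, hf⟩ := hX
    have hI := IsSES.of_mono (Abelian.image.ι f)
    obtain ⟨K, Q, i, p, hip, hK, hQ⟩ := ih _ _ hI fun h => hf (by
      rw [← Abelian.image.fac f, h.eq_of_src (Abelian.image.ι f) 0, comp_zero])
    have := hip.epi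
    have hk := IsSES.of_epi (cokernel.π (Abelian.image.ι f) ≫ p)
    obtain ⟨a, b, hab, -⟩ := hI.kernel_comp hip hk
    exact ⟨_, _, _, _, hk, T.of_ses hab (T.of_epi (Abelian.factorThruImage f) hE) hK, hQ⟩

/-- Torsion classes can be compared on objects that are torsion for one and torsion-free for
the other. -/
lemma le_of_isZero {T U : Tors A}
    (h : ∀ X, T.1 X → U.1.rightOrthogonal X → IsZero X) : T ≤ U := fun X hX => by
  obtain ⟨K, Q, i, p, hip, hK, hQ⟩ := U.exists_torsion_ses X
  have := hip.epi
  have := hip.isIso_left (h Q (T.of_epi p hX) hQ)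
  exact U.of_epi i hK

/-- In a length category, a subcategory that is closed under quotients and extensions and
contains the zero objects is a torsion class. -/
lemma prop_of_leftOrthogonal_rightOrthogonal {P : ObjectProperty A}
    (h₀ : ∀ X, IsZero X → P X)
    (hq : ∀ ⦃X Y : A⦄ (f : X ⟶ Y), Epi f → P X → P Y)
    (he : ∀ ⦃X Y Z : A⦄ (f : X ⟶ Y) (g : Y ⟶ Z), IsSES f g → P X → P Z → P Y)
    {X : A} (hX : P.rightOrthogonal.leftOrthogonal X) : P X := by
  induction X using quotient_induction with
  | h X ih =>
  by_cases hX' : P.rightOrthogonal X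
  · exact h₀ X ((IsZero.iff_id_eq_zero X).2 (hX (𝟙 X) hX'))
  · simp only [ObjectProperty.rightOrthogonal_iff, not_forall] at hX'
    obtain ⟨E, f, hE, hf⟩ := hX'
    have hI := IsSES.of_mono (Abelian.image.ι f)
    have hQ := ih _ _ hI (fun h => hf (by
      rw [← Abelian.image.fac f, h.eq_of_src (Abelian.image.ι f) 0, comp_zero]))
      (leftOrthogonal_of_epi (cokernel.π (Abelian.image.ι f)) hX)
    exact he _ _ hI (hq (Abelian.factorThruImage f) inferInstance hE) hQ

/-- Meet-semidistributivity of `tors A`. -/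
lemma inf_sSup_eq {x y : Tors A} {S : Set (Tors A)} (hS : S.Nonempty)
    (h : ∀ s ∈ S, x ⊓ s = y) : x ⊓ sSup S = y := by
  have hy : ∀ s ∈ S, y ≤ s := fun s hs => (h s hs).symm.le.trans inf_le_right
  obtain ⟨s₀, hs₀⟩ := hS
  refine le_antisymm (le_of_isZero fun N hN hN' => ?_)
    (le_inf ((h s₀ hs₀).symm.le.trans inf_le_left) ((hy s₀ hs₀).trans (le_sSup hs₀)))
  obtain ⟨hx, hsup⟩ := (inf_prop _ _ _).1 hN
  clear hN
  induction N using quotient_induction with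
  | h N ih =>
  by_contra hN0
  have : ¬ ∀ s ∈ S, s.1.rightOrthogonal N := fun hs =>
    hN0 ((sSup S).isZero hsup ((sSup_rightOrthogonal S N).2 hs))
  push Not at this
  obtain ⟨s, hs, hsN⟩ := this
  obtain ⟨K, Q, i, p, hip, hK, hQ⟩ := s.exists_torsion_ses N
  have := hip.epi
  have hQ0 : IsZero Q := by
    refine ih i p hip (fun hK0 => hsN ?_) (rightOrthogonal_anti (hy s hs) hQ) (x.of_epi p hx)
      ((sSup S).of_epi p hsup)
    have := hip.isIso_right hK0
    exact rightOrthogonal_of_mono p hQ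
  have := hip.isIso_left hQ0
  have hNs : s.1 N := s.of_epi i hK
  have hNy : y.1 N := by
    rw [← h s hs, inf_prop]
    exact ⟨hx, hNs⟩
  exact hN0 (y.isZero hNy hN')

/-- Join-semidistributivity of `tors A`. -/
lemma sup_sInf_eq {x y : Tors A} {S : Set (Tors A)} (hS : S.Nonempty)
    (h : ∀ s ∈ S, x ⊔ s = y) : x ⊔ sInf S = y := by
  have hy : ∀ s ∈ S, s ≤ y := fun s hs => le_sup_right.trans (h s hs).le
  obtain ⟨s₀, hs₀⟩ := hS
  refine le_antisymm
    (sup_le (le_sup_left.trans (h s₀ hs₀).le) ((sInf_le hs₀).trans (hy s₀ hs₀)))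
    (le_of_isZero fun N hN hN' => ?_)
  obtain ⟨hx, hinf⟩ := (sup_rightOrthogonal _ _ _).1 hN'
  clear hN'
  induction N using subobject_induction with
  | h N ih =>
  by_contra hN0
  have : ¬ ∀ s ∈ S, s.1 N := fun hs => hN0 ((sInf S).isZero ((sInf_prop S N).2 hs) hinf)
  push Not at this
  obtain ⟨s, hs, hsN⟩ := this
  obtain ⟨K, Q, i, p, hip, hK, hQ⟩ := s.exists_torsion_ses N
  have := hip.mono
  have hK0 : IsZero K := by
    refine ih i p hip (fun hQ0 => hsN ?_) (hy s hs _ hK) (rightOrthogonal_of_mono i hx)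
      (rightOrthogonal_of_mono i hinf)
    have := hip.isIso_left hQ0
    exact s.of_epi i hK
  have := hip.isIso_right hK0
  have hNs : s.1.rightOrthogonal N := rightOrthogonal_of_mono p hQ
  have hNy : y.1.rightOrthogonal N := by
    rw [← h s hs, sup_rightOrthogonal]
    exact ⟨hx, hNs⟩
  exact hN0 (y.isZero hN hNy)

end Tors

end TorsionClasses

/-! ### Wide subcategories and their simple objects -/

section WideSubcategories
open Limits ZeroObject

variable {A : Type u} [Category.{v} A] [Abelian A]

lemma isWide_of_closed {W : ObjectProperty A} [W.IsClosedUnderIsomorphisms] (h₀ : ∀ X, IsZero X → W X)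
    (he : ∀ ⦃X Y Z : A⦄ (f : X ⟶ Y) (g : Y ⟶ Z), IsSES f g → W X → W Z → W Y)
    (hk : ∀ ⦃X Y : A⦄ (f : X ⟶ Y), W X → W Y → W (kernel f))
    (hc : ∀ ⦃X Y : A⦄ (f : X ⟶ Y), W X → W Y → W (cokernel f)) : IsWide W where
  containsZero := ⟨_, isZero_zero A, h₀ _ (isZero_zero A)⟩
  isClosedUnderIsomorphisms := inferInstance
  isClosedUnderExtensions := ⟨fun {S} hS => he S.f S.g ⟨S.zero, hS⟩⟩
  isClosedUnderKernels := ⟨by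
    rintro _ ⟨f, k, h, hX, hY⟩
    exact W.prop_of_iso ((kernelIsKernel f).conePointUniqueUpToIso h) (hk f hX hY)⟩
  isClosedUnderCokernels := ⟨by
    rintro _ ⟨f, k, h, hX, hY⟩
    exact W.prop_of_iso ((cokernelIsCokernel f).coconePointUniqueUpToIso h) (hc f hX hY)⟩

/-- An object of `W` is simple in `W` if it is nonzero and every nonzero morphism of `W` out of it
is a monomorphism and every one into it is an epimorphism. -/
structure IsSimpleIn (W : ObjectProperty A) (S : A) : Prop where
  prop : W S
  not_isZero : ¬ IsZero S
  mono : ∀ ⦃Y : A⦄ (f : S ⟶ Y), W Y → f ≠ 0 → Mono f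
  epi : ∀ ⦃Y : A⦄ (f : Y ⟶ S), W Y → f ≠ 0 → Epi f

lemma IsSimpleIn.isIso {W : ObjectProperty A} {S S' : A} (h : IsSimpleIn W S)
    (h' : IsSimpleIn W S') {f : S ⟶ S'} (hf : f ≠ 0) : IsIso f := by
  have := h.mono f h'.prop hf
  have := h'.epi f h.prop hf
  exact isIso_of_mono_of_epi f

namespace IsWide

variable {W : ObjectProperty A}

lemma of_isZero (hW : IsWide W) {X : A} (h : IsZero X) : W X := by
  have := hW.containsZero
  have := hW.isClosedUnderIsomorphisms
  exact W.prop_of_isZero h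

lemma of_ses (hW : IsWide W) {X Y Z : A} {f : X ⟶ Y} {g : Y ⟶ Z} (h : IsSES f g)
    (hX : W X) (hZ : W Z) : W Y := by
  have := hW.isClosedUnderExtensions
  exact W.prop_X₂_of_shortExact h.2 hX hZ

lemma kernel_of_ses (hW : IsWide W) {X Y Z : A} {f : X ⟶ Y} {g : Y ⟶ Z} (h : IsSES f g)
    (hY : W Y) (hZ : W Z) : W X := by
  have := hW.isClosedUnderKernels
  have := h.mono
  exact W.prop_of_isLimit_kernelFork h.2.fIsKernel hY hZ

lemma cokernel_of_ses (hW : IsWide W) {X Y Z : A} {f : X ⟶ Y} {g : Y ⟶ Z} (h : IsSES f g)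
    (hX : W X) (hY : W Y) : W Z := by
  have := hW.isClosedUnderCokernels
  have := h.epi
  exact W.prop_of_isColimit_cokernelCofork h.2.gIsCokernel hX hY

lemma of_epi_mono (hW : IsWide W) {X I Y : A} (e : X ⟶ I) (m : I ⟶ Y) [Epi e] [Mono m]
    (hX : W X) (hY : W Y) : W I := by
  have := hW.isClosedUnderKernels
  have := hW.isClosedUnderIsomorphisms
  refine hW.cokernel_of_ses (IsSES.of_epi e) ?_ hX
  exact W.prop_of_iso (kernelCompMono e m) (W.prop_kernel (e ≫ m) hX hY)

lemma cokernel (hW : IsWide W) {X Y : A} (f : X ⟶ Y) (hX : W X) (hY : W Y) :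
    W (Limits.cokernel f) := by
  have := hW.isClosedUnderCokernels
  exact W.prop_cokernel f hX hY

lemma kernel (hW : IsWide W) {X Y : A} (f : X ⟶ Y) (hX : W X) (hY : W Y) :
    W (Limits.kernel f) := by
  have := hW.isClosedUnderKernels
  exact W.prop_kernel f hX hY

variable [IsLengthCategory A]

lemma exists_simple_quotient (hW : IsWide W) {X : A} (hX : W X) (h0 : ¬ IsZero X) :
    ∃ (S : A) (p : X ⟶ S), IsSimpleIn W S ∧ Epi p := by
  induction X using quotient_induction with
  | h X ih =>
  by_cases h : ∀ (Y : A) (f : X ⟶ Y), W Y → f ≠ 0 → Mono f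
  · refine ⟨X, 𝟙 X, ⟨hX, h0, h, fun Y f hY hf => ?_⟩, inferInstance⟩
    refine Preadditive.epi_of_cokernel_zero ?_
    by_contra hne
    have := h _ _ (hW.cokernel f hY hX) hne
    exact hf ((cancel_mono (cokernel.π f)).1 (by simp))
  · push Not at h
    obtain ⟨Y, f, hY, hf, hm⟩ := h
    have hs := IsSES.of_epi (Abelian.factorThruImage f)
    obtain ⟨S, p, hS, hp⟩ := ih _ _ hs
      (fun hz => hm (by
        have := hs.isIso_right hz
        rw [← Abelian.image.fac f]
        infer_instance))
      (hW.of_epi_mono (Abelian.factorThruImage f) (Abelian.image.ι f) hX hY)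
      (fun hz => hf (by rw [← Abelian.image.fac f, hz.eq_of_src (Abelian.image.ι f) 0, comp_zero]))
    exact ⟨S, Abelian.factorThruImage f ≫ p, hS, inferInstance⟩

lemma exists_simple_subobject (hW : IsWide W) {X : A} (hX : W X) (h0 : ¬ IsZero X) :
    ∃ (S : A) (i : S ⟶ X), IsSimpleIn W S ∧ Mono i := by
  induction X using subobject_induction with
  | h X ih =>
  by_cases h : ∀ (Y : A) (f : Y ⟶ X), W Y → f ≠ 0 → Epi f
  · refine ⟨X, 𝟙 X, ⟨hX, h0, fun Y f hY hf => ?_, h⟩, inferInstance⟩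
    refine Preadditive.mono_of_kernel_zero ?_
    by_contra hne
    have := h _ _ (hW.kernel f hX hY) hne
    exact hf ((cancel_epi (kernel.ι f)).1 (by simp))
  · push Not at h
    obtain ⟨Y, f, hY, hf, hm⟩ := h
    have hs := IsSES.of_mono (Abelian.image.ι f)
    obtain ⟨S, p, hS, hp⟩ := ih _ _ hs
      (fun hz => hm (by
        have := hs.isIso_left hz
        rw [← Abelian.image.fac f]
        infer_instance))
      (hW.of_epi_mono (Abelian.factorThruImage f) (Abelian.image.ι f) hY hX)
      (fun hz => hf (by rw [← Abelian.image.fac f, hz.eq_of_src (Abelian.image.ι f) 0, comp_zero]))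
    exact ⟨S, p ≫ Abelian.image.ι f, hS, inferInstance⟩

end IsWide

variable {U T : Tors A}

lemma sup_generated_eq_of_covBy {z : Tors A} (h : U ⋖ z) {B : A} (hBz : z.1 B)
    (hBU : U.1.rightOrthogonal B) (hB0 : ¬ IsZero B) : U ⊔ Tors.generated (· = B) = z := by
  refine (h.eq_or_eq le_sup_left (sup_le h.le (Tors.generated_singleton_le hBz))).resolve_left
    fun heq => hB0 (U.isZero ?_ hBU)
  rw [← heq]
  exact (le_sup_right : Tors.generated (· = B) ≤ _) B (Tors.le_generated rfl)

lemma inf_leftPerp_eq_of_covBy {z : Tors A} (h : z ⋖ T) {B : A} (hBT : T.1 B)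
    (hBz : z.1.rightOrthogonal B) (hB0 : ¬ IsZero B) : T ⊓ Tors.leftPerp (· = B) = z := by
  refine (h.eq_or_eq (le_inf h.le fun X hX => ?_) inf_le_left).resolve_right fun heq => hB0 ?_
  · exact (Tors.leftPerp_singleton_prop B X).2 fun f => hBz f hX
  · rw [← heq, Tors.inf_prop, Tors.leftPerp_singleton_prop] at hBT
    exact (IsZero.iff_id_eq_zero B).2 (hBT.2 _)

variable [IsLengthCategory A]

/-! ### Intervals with wide heart are binuclear -/

/-- If the heart of `[U, T]` is wide, then `T` is the join of `U` and of the atoms of `[U, T]`: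
each simple object `S` of the heart gives the atom `U ∨ T(S)`. -/
lemma eq_popUp_of_isWide (hUT : U ≤ T) (hW : IsWide (U.1.rightOrthogonal ⊓ T.1)) :
    T = popUp U T := by
  have hz : ∀ S, IsSimpleIn (U.1.rightOrthogonal ⊓ T.1) S →
      U ⋖ U ⊔ Tors.generated (· = S) ∧ U ⊔ Tors.generated (· = S) ≤ T := by
    intro S hS
    have hle : U ⊔ Tors.generated (· = S) ≤ T :=
      sup_le hUT (Tors.generated_singleton_le hS.prop.2)
    refine ⟨⟨lt_of_le_of_ne le_sup_left fun h => hS.not_isZero ?_, fun V hV hV' => ?_⟩, hle⟩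
    · refine U.isZero ?_ hS.prop.1
      rw [h]
      exact (le_sup_right : Tors.generated (· = S) ≤ _) S (Tors.le_generated rfl)
    · refine hV'.not_ge (sup_le hV.le (Tors.generated_singleton_le ?_))
      have hnot := mt Tors.le_of_isZero hV.not_ge
      push Not at hnot
      obtain ⟨X, hXV, hXU, hX0⟩ := hnot
      obtain ⟨S', p, hS', _⟩ :=
        hW.exists_simple_quotient ⟨hXU, hle X (hV'.le X hXV)⟩ hX0
      have hS'V : V.1 S' := V.of_epi p hXV
      have hne : ¬ ∀ f : S ⟶ S', f = 0 := fun h => hS'.not_isZero <|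
        (U ⊔ Tors.generated (· = S)).isZero (hV'.le S' hS'V)
          ((Tors.sup_rightOrthogonal _ _ _).2
            ⟨hS'.prop.1, (Tors.generated_singleton_rightOrthogonal S S').2 h⟩)
      push Not at hne
      obtain ⟨f, hf⟩ := hne
      have := hS.isIso hS' hf
      exact V.of_epi (inv f) hS'V
  refine le_antisymm (Tors.le_of_isZero fun X hXT hX => ?_)
    (sup_le hUT (sSup_le fun _ h => h.2))
  rw [popUp, Tors.sup_rightOrthogonal, Tors.sSup_rightOrthogonal] at hX
  by_contra hX0
  obtain ⟨S, i, hS, _⟩ := hW.exists_simple_subobject ⟨hX.1, hXT⟩ hX0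
  have h := ((Tors.sup_rightOrthogonal _ _ _).1 (hX.2 _ (hz S hS))).2
  rw [Tors.generated_singleton_rightOrthogonal] at h
  exact hS.not_isZero (IsZero.of_mono_eq_zero i (h i))

/-- If the heart of `[U, T]` is wide, then `U` is the meet of `T` and of the coatoms of `[U, T]`:
each simple object `S` of the heart gives the coatom `T ∧ ^⊥S`. -/
lemma eq_popDown_of_isWide (hUT : U ≤ T) (hW : IsWide (U.1.rightOrthogonal ⊓ T.1)) :
    U = popDown U T := by
  have hz : ∀ S, IsSimpleIn (U.1.rightOrthogonal ⊓ T.1) S →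
      U ≤ T ⊓ Tors.leftPerp (· = S) ∧ T ⊓ Tors.leftPerp (· = S) ⋖ T := by
    intro S hS
    have hle : U ≤ T ⊓ Tors.leftPerp (· = S) := le_inf hUT fun X hX =>
      (Tors.leftPerp_singleton_prop S X).2 fun f => hS.prop.1 f hX
    refine ⟨hle, lt_of_le_of_ne inf_le_left fun h => hS.not_isZero ?_, fun V hV hV' => ?_⟩
    · have hST := hS.prop.2
      rw [← h, Tors.inf_prop, Tors.leftPerp_singleton_prop] at hST
      exact (IsZero.iff_id_eq_zero S).2 (hST.2 _)
    · have hnot := mt Tors.le_of_isZero hV'.not_ge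
      push Not at hnot
      obtain ⟨X, hXT, hXV, hX0⟩ := hnot
      obtain ⟨S', i, hS', _⟩ := hW.exists_simple_subobject
        ⟨Tors.rightOrthogonal_anti (hle.trans hV.le) hXV, hXT⟩ hX0
      have hS'V : V.1.rightOrthogonal S' := rightOrthogonal_of_mono i hXV
      have hne : ¬ ∀ f : S' ⟶ S, f = 0 := fun h => hS'.not_isZero <|
        V.isZero (hV.le S' ((Tors.inf_prop _ _ _).2
          ⟨hS'.prop.2, (Tors.leftPerp_singleton_prop S S').2 h⟩)) hS'V
      push Not at hne
      obtain ⟨f, hf⟩ := hne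
      have := hS'.isIso hS hf
      have hSV : V.1.rightOrthogonal S := rightOrthogonal_of_mono (inv f) hS'V
      exact hV.not_ge (le_inf hV'.le fun Y hY =>
        (Tors.leftPerp_singleton_prop S Y).2 fun g => hSV g hY)
  refine le_antisymm (le_inf hUT (le_sInf fun _ h => h.1)) (Tors.le_of_isZero fun X hX hXU => ?_)
  rw [popDown, Tors.inf_prop, Tors.sInf_prop] at hX
  by_contra hX0
  obtain ⟨S, p, hS, _⟩ := hW.exists_simple_quotient ⟨hXU, hX.1⟩ hX0
  have h := ((Tors.inf_prop _ _ _).1 (hX.2 _ (hz S hS))).2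
  rw [Tors.leftPerp_singleton_prop] at h
  exact hS.not_isZero (IsZero.of_epi_eq_zero p (h p))

/-! ### Hearts of binuclear intervals are wide -/

/-- A nonzero torsion-free object has a nonzero torsion-free quotient that is minimal, in the sense
that it has no proper nonzero torsion-free quotient itself. -/
lemma exists_minimal_quotient {X : A} (hX : U.1.rightOrthogonal X) (h0 : ¬ IsZero X) :
    ∃ (B : A) (p : X ⟶ B), Epi p ∧ U.1.rightOrthogonal B ∧ ¬ IsZero B ∧
      ∀ ⦃Y : A⦄ (f : B ⟶ Y), U.1.rightOrthogonal Y → f ≠ 0 → Mono f := by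
  induction X using quotient_induction with
  | h X ih =>
  by_cases h : ∀ (Y : A) (f : X ⟶ Y), U.1.rightOrthogonal Y → f ≠ 0 → Mono f
  · exact ⟨X, 𝟙 X, inferInstance, hX, h0, h⟩
  · push Not at h
    obtain ⟨Y, f, hY, hf, hm⟩ := h
    have hs := IsSES.of_epi (Abelian.factorThruImage f)
    obtain ⟨B, p, _, hB⟩ := ih _ _ hs
      (fun hz => hm (by
        have := hs.isIso_right hz
        rw [← Abelian.image.fac f]
        infer_instance))
      (rightOrthogonal_of_mono (Abelian.image.ι f) hY)
      (fun hz => hf (by rw [← Abelian.image.fac f, hz.eq_of_src (Abelian.image.ι f) 0, comp_zero]))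
    exact ⟨B, Abelian.factorThruImage f ≫ p, inferInstance, hB⟩

/-- A nonzero torsion object has a nonzero torsion subobject that is minimal, in the sense that it
has no proper nonzero torsion subobject itself. -/
lemma exists_minimal_subobject {X : A} (hX : T.1 X) (h0 : ¬ IsZero X) :
    ∃ (B : A) (i : B ⟶ X), Mono i ∧ T.1 B ∧ ¬ IsZero B ∧
      ∀ ⦃Y : A⦄ (f : Y ⟶ B), T.1 Y → f ≠ 0 → Epi f := by
  induction X using subobject_induction with
  | h X ih =>
  by_cases h : ∀ (Y : A) (f : Y ⟶ X), T.1 Y → f ≠ 0 → Epi f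
  · exact ⟨X, 𝟙 X, inferInstance, hX, h0, h⟩
  · push Not at h
    obtain ⟨Y, f, hY, hf, hm⟩ := h
    have hs := IsSES.of_mono (Abelian.image.ι f)
    obtain ⟨B, p, _, hB⟩ := ih _ _ hs
      (fun hz => hm (by
        have := hs.isIso_left hz
        rw [← Abelian.image.fac f]
        infer_instance))
      (T.of_epi (Abelian.factorThruImage f) hY)
      (fun hz => hf (by rw [← Abelian.image.fac f, hz.eq_of_src (Abelian.image.ι f) 0, comp_zero]))
    exact ⟨B, p ≫ Abelian.image.ι f, inferInstance, hB⟩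

lemma isIso_of_mono_endo {X : A} (f : X ⟶ X) [Mono f] : IsIso f := by
  suffices H : ∀ Y : A, ∀ g : Y ⟶ Y, Mono g → IsIso g from H X f inferInstance
  intro Y
  induction Y using subobject_induction with
  | h Y ih =>
  intro g _
  by_cases h : IsZero (cokernel g)
  · exact (IsSES.of_mono g).isIso_left h
  -- `g` exhibits `Y` as a proper subobject of itself, so the induction hypothesis applies to `Y`.
  · exact ih g _ (IsSES.of_mono g) h g inferInstance

lemma isIso_of_epi_endo {X : A} (f : X ⟶ X) [Epi f] : IsIso f := by
  suffices H : ∀ Y : A, ∀ g : Y ⟶ Y, Epi g → IsIso g from H X f inferInstance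
  intro Y
  induction Y using quotient_induction with
  | h Y ih =>
  intro g _
  by_cases h : IsZero (kernel g)
  · exact (IsSES.of_epi g).isIso_right h
  · exact ih _ g (IsSES.of_epi g) h g inferInstance

/-- The object labelling a cover `U ⋖ z` behaves like a simple object towards the torsion-free
objects of `U`: nonzero morphisms out of it are monomorphisms with torsion-free cokernel. -/
lemma exists_label_of_covBy_up {z : Tors A} (h : U ⋖ z) :
    ∃ B, z.1 B ∧ U.1.rightOrthogonal B ∧ ¬ IsZero B ∧
      ∀ ⦃Y : A⦄ (f : B ⟶ Y), U.1.rightOrthogonal Y → f ≠ 0 →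
        Mono f ∧ U.1.rightOrthogonal (cokernel f) := by
  have hnot := mt Tors.le_of_isZero h.lt.not_ge
  push Not at hnot
  obtain ⟨X, hXz, hXU, hX0⟩ := hnot
  obtain ⟨B, p, _, hBU, hB0, hB⟩ := exists_minimal_quotient hXU hX0
  have hBz := z.of_epi p hXz
  refine ⟨B, hBz, hBU, hB0, fun Y f hY hf => ?_⟩
  have hm := hB f hY hf
  refine ⟨hm, ?_⟩
  obtain ⟨K, Q, i, q, hiq, hK, hQ⟩ := U.exists_torsion_ses (cokernel f)
  have hf' := IsSES.of_mono f
  have := hiq.epi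
  -- `E` is the preimage in `Y` of the `U`-torsion part `K` of `Y / B`.
  obtain ⟨E, c, hE⟩ : ∃ (E : A) (c : E ⟶ Y), IsSES c (cokernel.π f ≫ q) := ⟨_, _, IsSES.of_epi _⟩
  obtain ⟨a, b, hab, -⟩ := hf'.kernel_comp hiq hE
  have := hab.mono
  have := hE.mono
  have hEz : z.1 E := z.of_ses hab hBz (h.le K hK)
  have hEU : U.1.rightOrthogonal E := rightOrthogonal_of_mono c hY
  have hEB : ¬ ∀ g : E ⟶ B, g = 0 := by
    intro hg
    have hE0 : IsZero E := by
      refine U.isZero ?_ hEU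
      rw [← inf_leftPerp_eq_of_covBy h hBz hBU hB0, Tors.inf_prop, Tors.leftPerp_singleton_prop]
      exact ⟨hEz, hg⟩
    exact hB0 (IsZero.of_mono_eq_zero a (hE0.eq_of_tgt _ _))
  push Not at hEB
  obtain ⟨g, hg⟩ := hEB
  have hag : a ≫ g ≠ 0 := fun h0 => hg (by
    obtain ⟨l, rfl⟩ := hab.desc g h0
    rw [hBU l hK, comp_zero])
  have := hB _ hBU hag
  have := isIso_of_mono_endo (a ≫ g)
  -- `B` is a direct summand of `E`; its complement is isomorphic to `K` and torsion-free.
  obtain ⟨l, hl⟩ := hab.desc (𝟙 E - g ≫ inv (a ≫ g) ≫ a) (by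
    rw [Preadditive.comp_sub, Category.comp_id, ← Category.assoc, IsIso.hom_inv_id_assoc, sub_self])
  rw [hEU l hK, comp_zero, eq_comm, sub_eq_zero] at hl
  have : Epi a := by
    have : Epi ((g ≫ inv (a ≫ g)) ≫ a) := by
      rw [Category.assoc, ← hl]
      infer_instance
    exact epi_of_epi (g ≫ inv (a ≫ g)) a
  have := hiq.isIso_right hab.isZero_right
  exact rightOrthogonal_of_mono q hQ

/-- The object labelling a cover `z ⋖ T` behaves like a simple object towards the objects of `T`:
nonzero morphisms into it are epimorphisms with torsion kernel. -/
lemma exists_label_of_covBy_down {z : Tors A} (h : z ⋖ T) :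
    ∃ B, T.1 B ∧ z.1.rightOrthogonal B ∧ ¬ IsZero B ∧
      ∀ ⦃Y : A⦄ (f : Y ⟶ B), T.1 Y → f ≠ 0 → Epi f ∧ T.1 (kernel f) := by
  have hnot := mt Tors.le_of_isZero h.lt.not_ge
  push Not at hnot
  obtain ⟨X, hXT, hXz, hX0⟩ := hnot
  obtain ⟨B, i, _, hBT, hB0, hB⟩ := exists_minimal_subobject hXT hX0
  have hBz := rightOrthogonal_of_mono i hXz
  refine ⟨B, hBT, hBz, hB0, fun Y f hY hf => ?_⟩
  have hm := hB f hY hf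
  refine ⟨hm, ?_⟩
  obtain ⟨K, Q, j, q, hjq, hK, hQ⟩ := T.exists_torsion_ses (kernel f)
  have hf' := IsSES.of_epi f
  have := hjq.mono
  -- `E` is the quotient of `Y` by the `T`-torsion part of the kernel of `f`.
  obtain ⟨E, c, hE⟩ : ∃ (E : A) (c : Y ⟶ E), IsSES (j ≫ kernel.ι f) c := ⟨_, _, IsSES.of_mono _⟩
  obtain ⟨a, b, hab, -⟩ := hjq.cokernel_comp hf' hE
  have := hab.epi
  have := hE.epi
  have hET : T.1 E := T.of_epi c hY
  have hEz : z.1.rightOrthogonal E :=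
    hab.rightOrthogonal (Tors.rightOrthogonal_anti h.le hQ) hBz
  have hBE : ¬ ∀ g : B ⟶ E, g = 0 := by
    intro hg
    have hE0 : IsZero E := by
      refine T.isZero hET ?_
      rw [← sup_generated_eq_of_covBy h hBT hBz hB0, Tors.sup_rightOrthogonal,
        Tors.generated_singleton_rightOrthogonal]
      exact ⟨hEz, hg⟩
    exact hB0 (IsZero.of_epi_eq_zero b (hE0.eq_of_src _ _))
  push Not at hBE
  obtain ⟨g, hg⟩ := hBE
  have hgb : g ≫ b ≠ 0 := fun h0 => hg (by
    obtain ⟨l, rfl⟩ := hab.lift g h0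
    rw [hQ l hBT, zero_comp])
  have := hB _ hBT hgb
  have := isIso_of_epi_endo (g ≫ b)
  obtain ⟨l, hl⟩ := hab.lift (𝟙 E - b ≫ inv (g ≫ b) ≫ g) (by simp)
  rw [hQ l hET, zero_comp, eq_comm, sub_eq_zero] at hl
  have : Mono b := by
    have : Mono (b ≫ inv (g ≫ b) ≫ g) := by
      rw [← hl]
      infer_instance
    exact mono_of_mono b (inv (g ≫ b) ≫ g)
  have := hjq.isIso_left hab.isZero_left
  exact T.of_epi j hK

/-- If `T` is the join of `U` and of the atoms of `[U, T]`, then cokernels of monomorphisms from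
the heart to torsion-free objects are torsion-free. -/
lemma rightOrthogonal_of_eq_popUp (h : T = popUp U T) {X : A} (hXU : U.1.rightOrthogonal X)
    (hXT : T.1 X) {Y C : A} {f : X ⟶ Y} {g : Y ⟶ C} (hfg : IsSES f g)
    (hY : U.1.rightOrthogonal Y) : U.1.rightOrthogonal C := by
  induction X using quotient_induction generalizing Y with
  | h X ih =>
  by_cases hX0 : IsZero X
  · have := hfg.isIso_right hX0
    exact rightOrthogonal_of_mono (inv g) hY
  have hnot : ¬ T.1.rightOrthogonal X := fun hX => hX0 (T.isZero hXT hX)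
  rw [h, popUp, Tors.sup_rightOrthogonal, Tors.sSup_rightOrthogonal] at hnot
  push Not at hnot
  obtain ⟨z, ⟨hz, hzT⟩, hzX⟩ := hnot hXU
  obtain ⟨B, hBz, hBU, hB0, hB⟩ := exists_label_of_covBy_up hz
  rw [← sup_generated_eq_of_covBy hz hBz hBU hB0, Tors.sup_rightOrthogonal,
    Tors.generated_singleton_rightOrthogonal] at hzX
  push Not at hzX
  obtain ⟨i, hi⟩ := hzX hXU
  obtain ⟨_, hC⟩ := hB i hXU hi
  have hs := IsSES.of_mono i
  have := hfg.mono
  have hif : i ≫ f ≠ 0 := fun h0 => hi ((cancel_mono f).1 (by rw [h0, zero_comp]))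
  obtain ⟨_, hC'⟩ := hB (i ≫ f) hY hif
  obtain ⟨a, b, hab, -⟩ := hs.cokernel_comp hfg (IsSES.of_mono (i ≫ f))
  exact ih i (cokernel.π i) hs hB0 hC (T.of_epi (cokernel.π i) hXT) hab hC'

/-- If `U` is the meet of `T` and of the coatoms of `[U, T]`, then kernels of epimorphisms from
objects of `T` to the heart are in `T`. -/
lemma prop_of_eq_popDown (h : U = popDown U T) {X : A} (hXU : U.1.rightOrthogonal X)
    (hXT : T.1 X) {Y K : A} {f : K ⟶ Y} {g : Y ⟶ X} (hfg : IsSES f g)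
    (hY : T.1 Y) : T.1 K := by
  induction X using subobject_induction generalizing Y with
  | h X ih =>
  by_cases hX0 : IsZero X
  · have := hfg.isIso_left hX0
    exact T.of_epi (inv f) hY
  have hnot : ¬ U.1 X := fun hX => hX0 (U.isZero hX hXU)
  rw [h, popDown, Tors.inf_prop, Tors.sInf_prop] at hnot
  push Not at hnot
  obtain ⟨z, ⟨hUz, hz⟩, hzX⟩ := hnot hXT
  obtain ⟨B, hBT, hBz, hB0, hB⟩ := exists_label_of_covBy_down hz
  rw [← inf_leftPerp_eq_of_covBy hz hBT hBz hB0, Tors.inf_prop,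
    Tors.leftPerp_singleton_prop] at hzX
  push Not at hzX
  obtain ⟨p, hp⟩ := hzX hXT
  obtain ⟨_, hK⟩ := hB p hXT hp
  have hs := IsSES.of_epi p
  have := hfg.epi
  have hgp : g ≫ p ≠ 0 := fun h0 => hp ((cancel_epi g).1 (by rw [h0, comp_zero]))
  obtain ⟨_, hK'⟩ := hB (g ≫ p) hY hgp
  obtain ⟨a, b, hab, -⟩ := hfg.kernel_comp hs (IsSES.of_epi (g ≫ p))
  exact ih (kernel.ι p) p hs hB0 (rightOrthogonal_of_mono (kernel.ι p) hXU) hK hab hK'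

/-- The heart of a binuclear interval of torsion classes is wide. -/
lemma isWide_heart (I : Binuc (Tors A)) : IsWide (heart I) := by
  have : (heart I).IsClosedUnderIsomorphisms :=
    ⟨fun e h => ⟨rightOrthogonal_of_mono e.inv h.1, I.hi.of_epi e.hom h.2⟩⟩
  refine isWide_of_closed (fun X hX => ⟨fun _ f _ => hX.eq_of_tgt f 0, I.hi.of_isZero hX⟩)
    (fun X Y Z f g h hX hZ => ⟨h.rightOrthogonal hX.1 hZ.1, I.hi.of_ses h hX.2 hZ.2⟩)
    (fun X Y f hX hY => ⟨rightOrthogonal_of_mono (kernel.ι f) hX.1, ?_⟩)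
    (fun X Y f hX hY => ⟨?_, I.hi.of_epi (cokernel.π f) hY.2⟩)
  · exact prop_of_eq_popDown I.nuclear (rightOrthogonal_of_mono (Abelian.image.ι f) hY.1)
      (I.hi.of_epi (Abelian.factorThruImage f) hX.2) (IsSES.kernel_image f) hX.2
  · exact rightOrthogonal_of_eq_popUp I.conuclear
      (rightOrthogonal_of_mono (Abelian.image.ι f) hY.1)
      (I.hi.of_epi (Abelian.factorThruImage f) hX.2) (IsSES.of_epi (cokernel.π f)) hY.1

end WideSubcategories

/-! ### Endpoints of the intervals with a given wide heart -/

section Hearts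
open Limits

variable {A : Type u} [Category.{v} A] [Abelian A]

/-- The torsion classes `T` containing `W` such that every morphism from an object of `T` to an
object of `W` has its kernel in `T` and its image in `W`. For wide `W` these are the upper
endpoints of the intervals with heart `W`; the condition visibly passes to intersections. -/
structure IsUpperEnd (W : ObjectProperty A) (T : Tors A) : Prop where
  le : ∀ X, W X → T.1 X
  kernel_image : ∀ ⦃K X I V : A⦄ (k : K ⟶ X) (e : X ⟶ I) (m : I ⟶ V), IsSES k e → Mono m →
    T.1 X → W V → T.1 K ∧ W I

/-- The torsion classes `U` whose torsion-free class contains `W` and is such that every morphism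
from an object of `W` to a torsion-free object has torsion-free cokernel and its image in `W`. For
wide `W` these are the lower endpoints of the intervals with heart `W`; the condition visibly
passes to joins. -/
structure IsLowerEnd (W : ObjectProperty A) (U : Tors A) : Prop where
  le : ∀ X, W X → U.1.rightOrthogonal X
  image_cokernel : ∀ ⦃V I Y C : A⦄ (e : V ⟶ I) (m : I ⟶ Y) (c : Y ⟶ C), Epi e → IsSES m c →
    W V → U.1.rightOrthogonal Y → W I ∧ U.1.rightOrthogonal C

variable {W : ObjectProperty A}

lemma IsUpperEnd.sInf {S : Set (Tors A)} (hS : S.Nonempty) (h : ∀ T ∈ S, IsUpperEnd W T) :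
    IsUpperEnd W (sInf S) where
  le X hX := (Tors.sInf_prop _ _).2 fun T hT => (h T hT).le X hX
  kernel_image K X I V k e m hke hm hX hV := by
    rw [Tors.sInf_prop] at hX ⊢
    obtain ⟨T₀, hT₀⟩ := hS
    exact ⟨fun T hT => ((h T hT).kernel_image k e m hke hm (hX T hT) hV).1,
      ((h T₀ hT₀).kernel_image k e m hke hm (hX T₀ hT₀) hV).2⟩

lemma IsLowerEnd.sSup {S : Set (Tors A)} (hS : S.Nonempty) (h : ∀ U ∈ S, IsLowerEnd W U) :
    IsLowerEnd W (sSup S) where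
  le X hX := (Tors.sSup_rightOrthogonal _ _).2 fun T hT => (h T hT).le X hX
  image_cokernel V I Y C e m c he hmc hV hY := by
    rw [Tors.sSup_rightOrthogonal] at hY ⊢
    obtain ⟨U₀, hU₀⟩ := hS
    exact ⟨((h U₀ hU₀).image_cokernel e m c he hmc hV (hY U₀ hU₀)).1,
      fun U hU => ((h U hU).image_cokernel e m c he hmc hV (hY U hU)).2⟩

variable [IsLengthCategory A] {U T : Tors A}

lemma isUpperEnd_of_heart (hW : IsWide W) (hUT : U ≤ T)
    (h : U.1.rightOrthogonal ⊓ T.1 = W) : IsUpperEnd W T where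
  le X hX := by
    rw [← h] at hX
    exact hX.2
  kernel_image K X I V k e m hke hm hX hV := by
    have hVU := hV
    rw [← h] at hVU
    obtain ⟨L, Q, i, p, hip, hL, hQ⟩ := U.exists_torsion_ses X
    have := hip.epi
    have hQW : W Q := by
      rw [← h]
      exact ⟨hQ, T.of_epi p hX⟩
    obtain ⟨e', rfl⟩ := hip.desc e (rightOrthogonal_of_mono m hVU.1 _ hL)
    have := hke.epi
    have : Epi e' := epi_of_epi p e'
    have hI : W I := hW.of_epi_mono e' m hQW hV
    have hs := IsSES.of_epi e'
    obtain ⟨a, b, hab, -⟩ := hip.kernel_comp hs hke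
    have hk := hW.kernel e' hQW hI
    rw [← h] at hk
    exact ⟨T.of_ses hab (hUT _ hL) hk.2, hI⟩

lemma isLowerEnd_of_heart (hW : IsWide W) (hUT : U ≤ T)
    (h : U.1.rightOrthogonal ⊓ T.1 = W) : IsLowerEnd W U where
  le X hX := by
    rw [← h] at hX
    exact hX.1
  image_cokernel V I Y C e m c he hmc hV hY := by
    have hVT := hV
    rw [← h] at hVT
    obtain ⟨L, Q, i, p, hip, hL, hQ⟩ := T.exists_torsion_ses Y
    have := hip.mono
    have hLW : W L := by
      rw [← h]
      exact ⟨rightOrthogonal_of_mono i hY, hL⟩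
    obtain ⟨m', rfl⟩ := hip.lift m (hQ _ (T.of_epi e hVT.2))
    have := hmc.mono
    have : Mono m' := mono_of_mono m' i
    have hI : W I := hW.of_epi_mono e m' hV hLW
    obtain ⟨a, b, hab, -⟩ := (IsSES.of_mono m').cokernel_comp hip hmc
    have hk := hW.cokernel m' hI hLW
    rw [← h] at hk
    exact ⟨hI, hab.rightOrthogonal hk.1 (Tors.rightOrthogonal_anti hUT hQ)⟩

/-- The lower endpoint is determined by the heart and the upper endpoint. -/
lemma eq_inf_leftPerp_of_heart (hUT : U ≤ T) (h : U.1.rightOrthogonal ⊓ T.1 = W) :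
    U = T ⊓ Tors.leftPerp W := by
  subst h
  refine le_antisymm (le_inf hUT fun X hX Y f hY => hY.1 f hX)
    (Tors.le_of_isZero fun X hX hXU => ?_)
  rw [Tors.inf_prop] at hX
  exact (IsZero.iff_id_eq_zero X).2 (hX.2 _ ⟨hXU, hX.1⟩)

/-- The upper endpoint is determined by the heart and the lower endpoint. -/
lemma eq_sup_generated_of_heart (hUT : U ≤ T) (h : U.1.rightOrthogonal ⊓ T.1 = W) :
    T = U ⊔ Tors.generated W := by
  subst h
  refine le_antisymm (Tors.le_of_isZero fun X hX hX' => ?_)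
    (sup_le hUT (Tors.generated_le fun X hX => hX.2))
  rw [Tors.sup_rightOrthogonal, Tors.generated_rightOrthogonal] at hX'
  exact (IsZero.iff_id_eq_zero X).2 (hX'.2 _ ⟨hX'.1, hX⟩)

/-- The condition on upper endpoints is sufficient. An object `X` of the heart of
`[T ∧ ^⊥W, T]` is an extension of objects of `W`: passing to the kernel of a map to `W` stays in `T`,
and a minimal such kernel lies in `T ∧ ^⊥W`, so it vanishes. -/
lemma IsUpperEnd.heart_eq (hW : IsWide W) (hT : IsUpperEnd W T) :
    (T ⊓ Tors.leftPerp W).1.rightOrthogonal ⊓ T.1 = W := by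
  refine le_antisymm (fun X hX => ?_)
    fun X hX => ⟨fun Y f hY => ((Tors.inf_prop _ _ _).1 hY).2 f hX, hT.le X hX⟩
  -- If the kernel `K` of a map from `X` onto an object of `W` admits a nonzero map to `W`, it can
  -- be replaced by the smaller kernel of that map.
  have key : ∀ K : A, ∀ ⦃Q : A⦄ (k : K ⟶ X) (p : X ⟶ Q), IsSES k p → W Q → W X := by
    intro K
    induction K using subobject_induction with
    | h K ih =>
    intro Q k p hkp hQ
    have hK := (hT.kernel_image k p (𝟙 Q) hkp inferInstance hX.2 hQ).1
    by_cases hKW : W.leftOrthogonal K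
    · have hk0 : k = 0 := hX.1 k ((Tors.inf_prop _ _ _).2 ⟨hK, hKW⟩)
      have := hkp.mono
      have := hkp.isIso_right (IsZero.of_mono_eq_zero k hk0)
      have := hW.isClosedUnderIsomorphisms
      exact W.prop_of_iso (asIso p).symm hQ
    · simp only [ObjectProperty.leftOrthogonal_iff, not_forall] at hKW
      obtain ⟨V, f, hV, hf⟩ := hKW
      have hs := IsSES.kernel_image f
      have hI := (hT.kernel_image _ _ (Abelian.image.ι f) hs inferInstance hK hV).2
      have := hs.mono
      have := hkp.mono
      have hc := IsSES.of_mono (kernel.ι f ≫ k)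
      obtain ⟨a, b, hab, -⟩ := hs.cokernel_comp hkp hc
      refine ih _ _ hs (fun hz => hf ?_) _ _ hc (hW.of_ses hab hI hQ)
      rw [← Abelian.image.fac f, hz.eq_of_src (Abelian.image.ι f) 0, comp_zero]
  exact key X (𝟙 X) (cokernel.π (𝟙 X)) (IsSES.of_mono (𝟙 X))
    (hW.of_isZero (isZero_cokernel_of_epi (𝟙 X)))

/-- The condition on lower endpoints is sufficient, dually to `IsUpperEnd.heart_eq`. -/
lemma IsLowerEnd.heart_eq (hW : IsWide W) (hU : IsLowerEnd W U) :
    U.1.rightOrthogonal ⊓ (U ⊔ Tors.generated W).1 = W := by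
  refine le_antisymm (fun X hX => ?_) fun X hX => ⟨hU.le X hX,
    (le_sup_right : Tors.generated W ≤ _) X (Tors.le_generated hX)⟩
  have key : ∀ C : A, ∀ ⦃L : A⦄ (i : L ⟶ X) (c : X ⟶ C), IsSES i c → W L → W X := by
    intro C
    induction C using quotient_induction with
    | h C ih =>
    intro L i c hic hL
    have hC := (hU.image_cokernel (𝟙 L) i c inferInstance hic hL hX.1).2
    have := hic.epi
    by_cases hCW : W.rightOrthogonal C
    · have hC0 : IsZero C := (U ⊔ Tors.generated W).isZero (Tors.of_epi _ c hX.2)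
        ((Tors.sup_rightOrthogonal _ _ _).2 ⟨hC, (Tors.generated_rightOrthogonal _ _).2 hCW⟩)
      have := hic.isIso_left hC0
      have := hW.isClosedUnderIsomorphisms
      exact W.prop_of_iso (asIso i) hL
    · simp only [ObjectProperty.rightOrthogonal_iff, not_forall] at hCW
      obtain ⟨V, f, hV, hf⟩ := hCW
      have hs : IsSES (Abelian.image.ι f) (cokernel.π f) := IsSES.of_epi _
      have hI := (hU.image_cokernel (Abelian.factorThruImage f) _ _ inferInstance hs hV hC).1
      have hc := IsSES.of_epi (c ≫ cokernel.π f)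
      obtain ⟨a, b, hab, -⟩ := hic.kernel_comp hs hc
      refine ih _ _ hs (fun hz => hf ?_) _ _ hc (hW.of_ses hab hL hI)
      rw [← Abelian.image.fac f, hz.eq_of_src (Abelian.image.ι f) 0, comp_zero]
  exact key X (kernel.ι (𝟙 X)) (𝟙 X) (IsSES.of_epi (𝟙 X))
    (hW.of_isZero (isZero_kernel_of_mono (𝟙 X)))

/-- The torsion class generated by a wide subcategory `W` is an upper endpoint for `W`: the objects
satisfying the defining condition are closed under quotients and extensions. -/
lemma isUpperEnd_generated (hW : IsWide W) : IsUpperEnd W (Tors.generated W) where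
  le X hX := Tors.le_generated hX
  kernel_image := by
    set T := Tors.generated W
    let P : ObjectProperty A := fun X => T.1 X ∧ ∀ ⦃K I V : A⦄ (k : K ⟶ X) (e : X ⟶ I) (m : I ⟶ V),
      IsSES k e → Mono m → W V → T.1 K ∧ W I
    have hWP : ∀ X, W X → P X := fun X hX =>
      ⟨Tors.le_generated hX, fun K I V k e m hke hm hV => by
        have := hke.epi
        have hI := hW.of_epi_mono e m hX hV
        exact ⟨Tors.le_generated (hW.kernel_of_ses hke hX hI), hI⟩⟩
    have hPq : ∀ ⦃X Y : A⦄ (f : X ⟶ Y), Epi f → P X → P Y := by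
      refine fun X Y f _ hX => ⟨T.of_epi f hX.1, fun K I V k e m hke hm hV => ?_⟩
      have := hke.epi
      have hs := IsSES.of_epi (f ≫ e)
      obtain ⟨a, b, hab, -⟩ := (IsSES.of_epi f).kernel_comp hke hs
      have := hab.epi
      have h := hX.2 _ _ m hs hm hV
      exact ⟨T.of_epi b h.1, h.2⟩
    have hPe : ∀ ⦃X Y Z : A⦄ (f : X ⟶ Y) (g : Y ⟶ Z), IsSES f g → P X → P Z → P Y := by
      refine fun X Y Z f g hfg hX hZ =>
        ⟨T.of_ses hfg hX.1 hZ.1, fun K I V k e m hke hm hV => ?_⟩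
      have := hke.epi
      have := hfg.epi
      -- `I'` is the image of `X` in `I`, and `I / I'` is a quotient of `Z` embedded in `V / I'`.
      obtain ⟨I', e', i, _, _, hfac⟩ :
          ∃ (I' : A) (e' : X ⟶ I') (i : I' ⟶ I), Epi e' ∧ Mono i ∧ e' ≫ i = f ≫ e :=
        ⟨_, _, _, inferInstance, inferInstance, Abelian.image.fac (f ≫ e)⟩
      have hi := IsSES.of_mono i
      obtain ⟨e'', he''⟩ := hfg.desc (e ≫ cokernel.π i) (by
        rw [← Category.assoc, ← hfac, Category.assoc, hi.comp_eq_zero,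
          comp_zero])
      have : Epi e'' := by
        have : Epi (g ≫ e'') := by rw [he'']; infer_instance
        exact epi_of_epi g e''
      have h' := hX.2 _ e' (i ≫ m) (IsSES.of_epi e') inferInstance hV
      have him := IsSES.of_mono (i ≫ m)
      obtain ⟨a, b, hab, -⟩ := hi.cokernel_comp (IsSES.of_mono m) him
      have h'' := hZ.2 _ e'' a (IsSES.of_epi e'') hab.mono (hW.cokernel (i ≫ m) h'.2 hV)
      obtain ⟨c, d, hcd, -⟩ := hfg.kernels hi (IsSES.of_epi e') hke (IsSES.of_epi e'') hfac.symm he''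
      exact ⟨T.of_ses hcd h'.1 h''.1, hW.of_ses hi h'.2 h''.2⟩
    intro K X I V k e m hke hm hX hV
    have hPX : P X := Tors.prop_of_leftOrthogonal_rightOrthogonal
      (fun Y hY => hWP Y (hW.of_isZero hY)) hPq hPe
      (fun Y f hY => hX f fun Z g hZ => hY g (hWP Z hZ))
    exact hPX.2 k e m hke hm hV

/-- An interval of torsion classes with wide heart is binuclear. -/
def Binuc.ofIsWide (hW : IsWide W) (hUT : U ≤ T) (h : U.1.rightOrthogonal ⊓ T.1 = W) :
    Binuc (Tors A) where
  lo := U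
  hi := T
  lo_le_hi := hUT
  nuclear := eq_popDown_of_isWide hUT (h ▸ hW)
  conuclear := eq_popUp_of_isWide hUT (h ▸ hW)

lemma nonempty_withHeart (hW : IsWide W) : (withHeart W).Nonempty :=
  ⟨Binuc.ofIsWide hW inf_le_left ((isUpperEnd_generated hW).heart_eq hW),
    (isUpperEnd_generated hW).heart_eq hW⟩

end Hearts

/-! ### Meets and joins of intervals with a given heart -/

section ComponentwiseBounds

variable {L : Type u} [CompleteLattice L]

lemma Binuc.isGLB_of_eq_sInf {S : Set (Binuc L)} {K : Binuc L} (h₁ : K.lo = sInf (Binuc.lo '' S))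
    (h₂ : K.hi = sInf (Binuc.hi '' S)) : IsGLB S K :=
  ⟨fun _ hI => ⟨h₁.le.trans (sInf_le (Set.mem_image_of_mem _ hI)),
      h₂.le.trans (sInf_le (Set.mem_image_of_mem _ hI))⟩,
    fun _ hJ => ⟨h₁.ge.trans' (le_sInf (Set.forall_mem_image.2 fun _ hI => (hJ hI).1)),
      h₂.ge.trans' (le_sInf (Set.forall_mem_image.2 fun _ hI => (hJ hI).2))⟩⟩

lemma Binuc.isLUB_of_eq_sSup {S : Set (Binuc L)} {K : Binuc L} (h₁ : K.lo = sSup (Binuc.lo '' S))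
    (h₂ : K.hi = sSup (Binuc.hi '' S)) : IsLUB S K :=
  ⟨fun _ hI => ⟨h₁.ge.trans' (le_sSup (Set.mem_image_of_mem _ hI)),
      h₂.ge.trans' (le_sSup (Set.mem_image_of_mem _ hI))⟩,
    fun _ hJ => ⟨h₁.le.trans (sSup_le (Set.forall_mem_image.2 fun _ hI => (hJ hI).1)),
      h₂.le.trans (sSup_le (Set.forall_mem_image.2 fun _ hI => (hJ hI).2))⟩⟩

variable {A : Type u} [Category.{v} A] [Abelian A] [IsLengthCategory A] {W : ObjectProperty A}

lemma exists_isGLB_withHeart (hW : IsWide W) {S : Set (Binuc (Tors A))} (hS : S.Nonempty)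
    (h : S ⊆ withHeart W) :
    ∃ K ∈ withHeart W, K.lo = sInf (Binuc.lo '' S) ∧ K.hi = sInf (Binuc.hi '' S) ∧ IsGLB S K := by
  have hT : IsUpperEnd W (sInf (Binuc.hi '' S)) := IsUpperEnd.sInf (hS.image _)
    (Set.forall_mem_image.2 fun I hI => isUpperEnd_of_heart hW I.lo_le_hi (h hI))
  have hlo : sInf (Binuc.hi '' S) ⊓ Tors.leftPerp W = sInf (Binuc.lo '' S) := by
    have hI : ∀ I ∈ S, I.lo = I.hi ⊓ Tors.leftPerp W :=
      fun I hI => eq_inf_leftPerp_of_heart I.lo_le_hi (h hI)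
    refine le_antisymm (le_sInf (Set.forall_mem_image.2 fun I hIS => ?_))
      (le_inf (le_sInf (Set.forall_mem_image.2 fun I hIS => ?_)) ?_)
    · rw [hI I hIS]
      exact inf_le_inf_right _ (sInf_le (Set.mem_image_of_mem _ hIS))
    · exact (sInf_le (Set.mem_image_of_mem _ hIS)).trans I.lo_le_hi
    · obtain ⟨I, hIS⟩ := hS
      exact (sInf_le (Set.mem_image_of_mem _ hIS)).trans ((hI I hIS).le.trans inf_le_right)
  let K := Binuc.ofIsWide hW inf_le_left (hT.heart_eq hW)
  exact ⟨K, hT.heart_eq hW, hlo, rfl, Binuc.isGLB_of_eq_sInf hlo rfl⟩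

lemma exists_isLUB_withHeart (hW : IsWide W) {S : Set (Binuc (Tors A))} (hS : S.Nonempty)
    (h : S ⊆ withHeart W) :
    ∃ K ∈ withHeart W, K.lo = sSup (Binuc.lo '' S) ∧ K.hi = sSup (Binuc.hi '' S) ∧ IsLUB S K := by
  have hU : IsLowerEnd W (sSup (Binuc.lo '' S)) := IsLowerEnd.sSup (hS.image _)
    (Set.forall_mem_image.2 fun I hI => isLowerEnd_of_heart hW I.lo_le_hi (h hI))
  have hhi : sSup (Binuc.lo '' S) ⊔ Tors.generated W = sSup (Binuc.hi '' S) := by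
    have hI : ∀ I ∈ S, I.hi = I.lo ⊔ Tors.generated W :=
      fun I hI => eq_sup_generated_of_heart I.lo_le_hi (h hI)
    refine le_antisymm (sup_le (sSup_le (Set.forall_mem_image.2 fun I hIS => ?_)) ?_)
      (sSup_le (Set.forall_mem_image.2 fun I hIS => ?_))
    · exact I.lo_le_hi.trans (le_sSup (Set.mem_image_of_mem _ hIS))
    · obtain ⟨I, hIS⟩ := hS
      exact (le_sup_right.trans (hI I hIS).ge).trans (le_sSup (Set.mem_image_of_mem _ hIS))
    · rw [hI I hIS]
      exact sup_le_sup_right (le_sSup (Set.mem_image_of_mem _ hIS)) _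
  let K := Binuc.ofIsWide hW le_sup_left (hU.heart_eq hW)
  exact ⟨K, hU.heart_eq hW, rfl, hhi, Binuc.isLUB_of_eq_sSup rfl hhi⟩

/-- Bounds of nonempty families in `C(W)` are computed componentwise. -/
lemma isGLB_withHeart_iff (hW : IsWide W) {S : Set (withHeart W)} (hS : S.Nonempty)
    (b : withHeart W) : IsGLB S b ↔
      IsGLB ((fun I => I.1.lo) '' S) b.1.lo ∧ IsGLB ((fun I => I.1.hi) '' S) b.1.hi := by
  obtain ⟨K, hKW, hlo, hhi, hK⟩ := exists_isGLB_withHeart hW (hS.image Subtype.val)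
    (Set.image_subset_iff.2 fun I _ => I.2)
  rw [Set.image_image] at hlo hhi
  have hKS : IsGLB S ⟨K, hKW⟩ :=
    ⟨fun I hI => hK.1 (Set.mem_image_of_mem _ hI),
      fun J hJ => hK.2 (Set.forall_mem_image.2 fun I hI => hJ hI)⟩
  constructor
  · intro hb
    obtain rfl := hb.unique hKS
    rw [hlo, hhi]
    exact ⟨isGLB_sInf _, isGLB_sInf _⟩
  · rintro ⟨h₁, h₂⟩
    have : b = ⟨K, hKW⟩ := Subtype.ext
      (Binuc.ext (h₁.sInf_eq.symm.trans hlo.symm) (h₂.sInf_eq.symm.trans hhi.symm))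
    rwa [this]

lemma isLUB_withHeart_iff (hW : IsWide W) {S : Set (withHeart W)} (hS : S.Nonempty)
    (b : withHeart W) : IsLUB S b ↔
      IsLUB ((fun I => I.1.lo) '' S) b.1.lo ∧ IsLUB ((fun I => I.1.hi) '' S) b.1.hi := by
  obtain ⟨K, hKW, hlo, hhi, hK⟩ := exists_isLUB_withHeart hW (hS.image Subtype.val)
    (Set.image_subset_iff.2 fun I _ => I.2)
  rw [Set.image_image] at hlo hhi
  have hKS : IsLUB S ⟨K, hKW⟩ :=
    ⟨fun I hI => hK.1 (Set.mem_image_of_mem _ hI),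
      fun J hJ => hK.2 (Set.forall_mem_image.2 fun I hI => hJ hI)⟩
  constructor
  · intro hb
    obtain rfl := hb.unique hKS
    rw [hlo, hhi]
    exact ⟨isLUB_sSup _, isLUB_sSup _⟩
  · rintro ⟨h₁, h₂⟩
    have : b = ⟨K, hKW⟩ := Subtype.ext
      (Binuc.ext (h₁.sSup_eq.symm.trans hlo.symm) (h₂.sSup_eq.symm.trans hhi.symm))
    rwa [this]

lemma Tors.isGLB_pair_sSup {x y b : Tors A} {S : Set (Tors A)} (hS : S.Nonempty)
    (h : ∀ s ∈ S, IsGLB {x, s} y) (hb : IsLUB S b) : IsGLB {x, b} y := by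
  rw [hb.sSup_eq.symm, ← Tors.inf_sSup_eq hS fun s hs => isGLB_pair.unique (h s hs)]
  exact isGLB_pair

lemma Tors.isLUB_pair_sInf {x y b : Tors A} {S : Set (Tors A)} (hS : S.Nonempty)
    (h : ∀ s ∈ S, IsLUB {x, s} y) (hb : IsGLB S b) : IsLUB {x, b} y := by
  rw [hb.sInf_eq.symm, ← Tors.sup_sInf_eq hS fun s hs => isLUB_pair.unique (h s hs)]
  exact isLUB_pair

lemma isCompletelySemidistributive_withHeart (hW : IsWide W) :
    IsCompletelySemidistributive (withHeart W) := by
  have hne : (Set.univ : Set (withHeart W)).Nonempty := by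
    obtain ⟨I, hI⟩ := nonempty_withHeart hW
    exact ⟨⟨I, hI⟩, trivial⟩
  have hglb : ∀ S : Set (withHeart W), S.Nonempty → ∃ a, IsGLB S a := fun S hS => by
    obtain ⟨K, hKW, -, -, hK⟩ := exists_isGLB_withHeart hW (hS.image Subtype.val)
      (Set.image_subset_iff.2 fun I _ => I.2)
    exact ⟨⟨K, hKW⟩, fun I hI => hK.1 (Set.mem_image_of_mem _ hI),
      fun J hJ => hK.2 (Set.forall_mem_image.2 fun I hI => hJ hI)⟩
  have hlub : ∀ S : Set (withHeart W), S.Nonempty → ∃ a, IsLUB S a := fun S hS => by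
    obtain ⟨K, hKW, -, -, hK⟩ := exists_isLUB_withHeart hW (hS.image Subtype.val)
      (Set.image_subset_iff.2 fun I _ => I.2)
    exact ⟨⟨K, hKW⟩, fun I hI => hK.1 (Set.mem_image_of_mem _ hI),
      fun J hJ => hK.2 (Set.forall_mem_image.2 fun I hI => hJ hI)⟩
  refine ⟨fun S => ?_, fun S => ?_, fun x y S hS h b hb => ?_, fun x y S hS h b hb => ?_⟩
  · obtain rfl | hS := S.eq_empty_or_nonempty
    · obtain ⟨a, ha⟩ := hglb _ hne
      exact ⟨a, fun _ h => h.elim, fun _ _ => ha.1 trivial⟩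
    · exact hlub S hS
  · obtain rfl | hS := S.eq_empty_or_nonempty
    · obtain ⟨a, ha⟩ := hlub _ hne
      exact ⟨a, fun _ h => h.elim, fun _ _ => ha.1 trivial⟩
    · exact hglb S hS
  · simp only [isGLB_withHeart_iff hW (Set.insert_nonempty _ _), Set.image_pair] at h ⊢
    rw [isLUB_withHeart_iff hW hS] at hb
    exact ⟨Tors.isGLB_pair_sSup (hS.image _) (Set.forall_mem_image.2 fun s hs => (h s hs).1) hb.1,
      Tors.isGLB_pair_sSup (hS.image _) (Set.forall_mem_image.2 fun s hs => (h s hs).2) hb.2⟩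
  · simp only [isLUB_withHeart_iff hW (Set.insert_nonempty _ _), Set.image_pair] at h ⊢
    rw [isGLB_withHeart_iff hW hS] at hb
    exact ⟨Tors.isLUB_pair_sInf (hS.image _) (Set.forall_mem_image.2 fun s hs => (h s hs).1) hb.1,
      Tors.isLUB_pair_sInf (hS.image _) (Set.forall_mem_image.2 fun s hs => (h s hs).2) hb.2⟩

lemma isSublatticeOf_withHeart (hW : IsWide W) : IsSublatticeOf (withHeart W) := by
  intro I hI J hJ
  have hs : {I, J} ⊆ withHeart W := Set.insert_subset hI (Set.singleton_subset_iff.2 hJ)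
  constructor
  · intro K hK
    obtain ⟨K', hK', -, -, h⟩ := exists_isLUB_withHeart hW (Set.insert_nonempty _ _) hs
    rwa [hK.unique h]
  · intro K hK
    obtain ⟨K', hK', -, -, h⟩ := exists_isGLB_withHeart hW (Set.insert_nonempty _ _) hs
    rwa [hK.unique h]

end ComponentwiseBounds

/-! ### Intervals with zero heart, and the partition by hearts -/

section ZeroHeart
open Limits

variable {A : Type u} [Category.{v} A] [Abelian A]

lemma isWide_zeroSubcategory : IsWide (zeroSubcategory : ObjectProperty A) := by
  have : (zeroSubcategory : ObjectProperty A).IsClosedUnderIsomorphisms :=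
    ⟨fun e h => h.of_iso e.symm⟩
  exact isWide_of_closed (fun _ h => h) (fun _ _ _ _ _ h hX hZ => h.2.exact.isZero_of_both_isZero hX hZ)
    (fun _ _ f hX _ => hX.of_mono (kernel.ι f)) (fun _ _ f _ hY => hY.of_epi (cokernel.π f))

lemma heart_self (T : Tors A) : T.1.rightOrthogonal ⊓ T.1 = zeroSubcategory :=
  le_antisymm (fun _ h => T.isZero h.2 h.1) fun _ h => ⟨fun _ f _ => h.eq_of_tgt f 0, T.of_isZero h⟩

variable [IsLengthCategory A]

/-- The torsion classes as the trivial intervals `[T, T]`, which are those with zero heart. -/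
def torsOrderIsoWithHeartZero : Tors A ≃o withHeart (zeroSubcategory : ObjectProperty A) where
  toFun T := ⟨Binuc.ofIsWide isWide_zeroSubcategory le_rfl (heart_self T), heart_self T⟩
  invFun I := I.1.lo
  left_inv _ := rfl
  right_inv I := Subtype.ext (Binuc.ext rfl (I.1.lo_le_hi.antisymm
    (Tors.le_of_isZero fun X h₁ h₂ => by
      have h : heart I.1 X := ⟨h₂, h₁⟩
      rwa [show heart I.1 = zeroSubcategory from I.2] at h)))
  map_rel_iff' := ⟨fun h => h.1, fun h => ⟨h, h⟩⟩

end ZeroHeart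

theorem theorem8p4 (A : Type u) [Category.{v} A] [Abelian A] [IsLengthCategory A] :
    -- the lattices `C(W)` for `W` wide
    (∀ W : ObjectProperty A, IsWide W →
      IsCompletelySemidistributive (withHeart W) ∧
      -- nonempty meets and joins in `C(W)` are computed componentwise in `tors A`,
      -- and are also meets and joins in the whole poset of binuclear intervals
      (∀ 𝓘 : Set (Binuc (Tors A)), 𝓘.Nonempty → 𝓘 ⊆ withHeart W →
        (∃ K ∈ withHeart W, K.lo = sInf (Binuc.lo '' 𝓘) ∧ K.hi = sInf (Binuc.hi '' 𝓘) ∧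
          IsGLB 𝓘 K) ∧
        (∃ K ∈ withHeart W, K.lo = sSup (Binuc.lo '' 𝓘) ∧ K.hi = sSup (Binuc.hi '' 𝓘) ∧
          IsLUB 𝓘 K)) ∧
      (IsLatticeOrder (Binuc (Tors A)) → IsSublatticeOf (withHeart W))) ∧
    -- `W = 0` recovers `tors A` through `T ↦ [T, T]`, compatibly with meets and joins
    IsWide (zeroSubcategory : ObjectProperty A) ∧
    (∃ e : Tors A ≃o withHeart (zeroSubcategory : ObjectProperty A),
      (∀ T, (e T).1.lo = T ∧ (e T).1.hi = T) ∧
      ∀ T U, IsGLB {(e T).1, (e U).1} (e (T ⊓ U)).1 ∧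
        IsLUB {(e T).1, (e U).1} (e (T ⊔ U)).1) ∧
    -- the sets `C(W)` partition the set of all binuclear intervals
    Setoid.IsPartition {S : Set (Binuc (Tors A)) | ∃ W, IsWide W ∧ S = withHeart W} := by
  refine ⟨fun W hW => ⟨isCompletelySemidistributive_withHeart hW, fun 𝓘 hne h =>
    ⟨exists_isGLB_withHeart hW hne h, exists_isLUB_withHeart hW hne h⟩,
    fun _ => isSublatticeOf_withHeart hW⟩, isWide_zeroSubcategory,
    ⟨torsOrderIsoWithHeartZero, fun T => ⟨rfl, rfl⟩, fun T U => ⟨?_, ?_⟩⟩, ?_, fun I => ?_⟩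
  · refine Binuc.isGLB_of_eq_sInf ?_ ?_ <;> rw [Set.image_pair, sInf_pair] <;> rfl
  · refine Binuc.isLUB_of_eq_sSup ?_ ?_ <;> rw [Set.image_pair, sSup_pair] <;> rfl
  · rintro ⟨W, hW, h⟩
    exact (nonempty_withHeart hW).ne_empty h.symm
  · refine ⟨withHeart (heart I), ⟨⟨heart I, isWide_heart I, rfl⟩, rfl⟩, ?_⟩
    rintro _ ⟨⟨W, -, rfl⟩, hI⟩
    rw [show heart I = W from hI]
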